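/- Let $F(x)=(x+1)/2$, $x\in[-1,1]$, be the distribution function of the uniform law $U[-1,1]$. For $t\in[0,2]$ let $\mathcal Q(t)$ be the integral operator on $L^2([-1,1],dF)$ given by $$\mathcal Q(t)[v](x)=\int_{-1}^{1}\bigl(I\{|x-y|<t\}-I\{|x+y|<t\}\bigr)\,v(y)\,dF(y)=\frac12\int_{-1}^{1}\bigl(I\{|x-y|<t\}-I\{|x+y|<t\}\bigr)\,v(y)\,dy .$$ For every $t\in[0,2]$ the operator $\mathcal Q(t)$ has an eigenvalue of largest absolute value; let $\nu_1(t)$ denote such an eigenvalue, and put $\varkappa_0=\sup_{t\in[0,2]}|\nu_1(t)|$. Then the supremum is attained at $t=2/3$, and $$\varkappa_0=\nu_1\Bigl(\frac23\Bigr)=\frac{\sqrt2}{3}\Bigl(\arctan\frac1{\sqrt2}\Bigr)^{-1}.$$ -/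

import Mathlib

open MeasureTheory

noncomputable section

/-- The kernel `ξ(x, y; t) = I{|x - y| < t} - I{|x + y| < t}`. -/
def xiKernel (t x y : ℝ) : ℝ :=
  (if |x - y| < t then 1 else 0) - (if |x + y| < t then 1 else 0)

theorem measurable_xiKernel (t : ℝ) : Measurable fun p : ℝ × ℝ => xiKernel t p.1 p.2 := by
  unfold xiKernel
  refine Measurable.sub ?_ ?_
  · exact Measurable.ite (measurableSet_lt (by fun_prop) measurable_const)
      measurable_const measurable_const
  · exact Measurable.ite (measurableSet_lt (by fun_prop) measurable_const)
      measurable_const measurable_const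

theorem norm_xiKernel_le (t x y : ℝ) : ‖xiKernel t x y‖ ≤ 1 := by
  unfold xiKernel
  split_ifs <;> simp

theorem integrable_xiKernel_mul (μ : Measure ℝ) [IsFiniteMeasure μ] (t x : ℝ)
    (v : Lp ℝ 2 μ) : Integrable (fun y => xiKernel t x y * v y) μ := by
  have hv : Integrable (fun y => v y) μ := (Lp.memLp v).integrable (by norm_num)
  exact hv.bdd_mul
    ((measurable_xiKernel t).comp measurable_prodMk_left).aestronglyMeasurable
    (Filter.Eventually.of_forall (norm_xiKernel_le t x))

theorem memLp_xiKernel_integral (μ : Measure ℝ) [IsFiniteMeasure μ] (t : ℝ) (v : Lp ℝ 2 μ) :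
    MemLp (fun x => ∫ y, xiKernel t x y * v y ∂μ) 2 μ := by
  have hv : Integrable (fun y => v y) μ := (Lp.memLp v).integrable (by norm_num)
  refine MemLp.of_bound ?_ (∫ y, ‖v y‖ ∂μ) (Filter.Eventually.of_forall fun x => ?_)
  · have h : StronglyMeasurable fun p : ℝ × ℝ => xiKernel t p.1 p.2 * v p.2 :=
      (measurable_xiKernel t).stronglyMeasurable.mul
        ((Lp.stronglyMeasurable v).comp_measurable measurable_snd)
    exact h.integral_prod_right'.aestronglyMeasurable
  · refine norm_integral_le_of_norm_le hv.norm (Filter.Eventually.of_forall fun y => ?_)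
    rw [norm_mul]
    exact mul_le_of_le_one_left (norm_nonneg _) (norm_xiKernel_le t x y)

/-- The integral operator `Q_F(t)[v](x) = ∫ ξ(x, y; t) v(y) dF(y)` on `L²(dF)`, where the
measure `μ` is `dF`. -/
def opQ (μ : Measure ℝ) [IsFiniteMeasure μ] (t : ℝ) : Module.End ℝ (Lp ℝ 2 μ) where
  toFun v := (memLp_xiKernel_integral μ t v).toLp _
  map_add' v w := by
    rw [← MemLp.toLp_add, MemLp.toLp_eq_toLp_iff]
    refine Filter.Eventually.of_forall fun x => ?_
    simp only [Pi.add_apply]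
    rw [← integral_add (integrable_xiKernel_mul μ t x v) (integrable_xiKernel_mul μ t x w)]
    refine integral_congr_ae ?_
    filter_upwards [Lp.coeFn_add v w] with y hy
    rw [hy, Pi.add_apply, mul_add]
  map_smul' c v := by
    rw [RingHom.id_apply, ← MemLp.toLp_const_smul, MemLp.toLp_eq_toLp_iff]
    refine Filter.Eventually.of_forall fun x => ?_
    simp only [Pi.smul_apply, smul_eq_mul]
    rw [← integral_const_mul]
    refine integral_congr_ae ?_
    filter_upwards [Lp.coeFn_smul c v] with y hy
    rw [hy, Pi.smul_apply, smul_eq_mul]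
    ring

/-- The uniform distribution on `[-1, 1]`, with distribution function `(x + 1) / 2` there. -/
def uniformLaw : Measure ℝ := ProbabilityTheory.cond volume (Set.Icc (-1 : ℝ) 1)

instance : IsProbabilityMeasure uniformLaw :=
  ProbabilityTheory.cond_isProbabilityMeasure_of_finite (by simp) (by simp)

/-- `ν` is an eigenvalue of `T` of largest absolute value. -/
def IsDominantEigenvalue {E : Type*} [AddCommGroup E] [Module ℝ E] (T : Module.End ℝ E)
    (ν : ℝ) : Prop :=
  T.HasEigenvalue ν ∧ ∀ ν' : ℝ, T.HasEigenvalue ν' → |ν'| ≤ |ν|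

end

/-! The kernel is odd in each variable, and its absolute value on `[-1, 1]²` is the even extension
of the indicator of `|x - y| < t ≤ x + y` on `[0, 1]²`. Everything therefore reduces to a
nonnegative symmetric kernel on `[0, 1]` with Lebesgue measure, which for `t ≤ 1` integrates over
the window from `|y - t|` to `min 1 (y + t)`.

Upper bound. By a Schur test, a positive `h` whose window integrals are at most `k * h` forces `|ν|
≤ k` for every eigenvalue. Such an `h` is exhibited with `k = criticalValue`: a single sine for `t ≤
1/2` (`abs_eigenvalue_opQ_le_of_le_half`), and piecewise functions on `[1/2, 2/3)` and `[2/3, 1]`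
(`exists_supersolution_of_lt_two_thirds`, `exists_supersolution_of_two_thirds_le`). For `t ≥ 1` the
kernel is dominated by the one at `t = 1`.

Attainment. At `t = 2/3` the extra pieces of `h` disappear and the sine-cosine pair that remains is
an exact eigenfunction (`hasEigenvalue_opQ_two_thirds`). Its two pieces are consistent when `k * w =
√2` and `tan (w / 3) = 1 / √2`, which produces the stated value.

Sign. Maximality of the absolute value leaves `±criticalValue` at `t = 2/3`. Subtracting a positive
semidefinite rank-one kernel leaves row integrals at most `2/3`, so no eigenvalue lies below `-2/3`,
and `2/3 < criticalValue` (`neg_le_eigenvalue_opQ_two_thirds`).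

Existence of a dominant eigenvalue follows from Bessel's inequality: only finitely many eigenvalues
exceed a given positive size, and `0` is always an eigenvalue. -/

/-! ### Symmetries of the kernel and reduction to `[0, 1]`. -/

theorem xiKernel_comm (t x y : ℝ) : xiKernel t x y = xiKernel t y x := by
  unfold xiKernel
  rw [abs_sub_comm, add_comm]

theorem xiKernel_neg_right (t x y : ℝ) : xiKernel t x (-y) = -xiKernel t x y := by
  unfold xiKernel
  rw [sub_neg_eq_add, ← sub_eq_add_neg]
  ring

theorem xiKernel_neg_left (t x y : ℝ) : xiKernel t (-x) y = -xiKernel t x y := by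
  rw [xiKernel_comm, xiKernel_neg_right, xiKernel_comm]

theorem xiKernel_of_nonneg {t x y : ℝ} (hx : 0 ≤ x) (hy : 0 ≤ y) :
    xiKernel t x y = if |x - y| < t ∧ t ≤ x + y then 1 else 0 := by
  unfold xiKernel
  have h : |x + y| = x + y := abs_of_nonneg (by positivity)
  have h' : |x - y| ≤ x + y := abs_le.2 ⟨by linarith, by linarith⟩
  rw [h]
  by_cases h1 : |x - y| < t <;> by_cases h2 : x + y < t
  · simp [h1, h2]
  · simp [h1, h2, not_lt.1 h2]
  · exact absurd (h'.trans_lt h2) h1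
  · simp [h1, h2]

theorem abs_xiKernel (t x y : ℝ) : |xiKernel t x y| = xiKernel t |x| |y| := by
  have h : |xiKernel t (|x|) (|y|)| = xiKernel t |x| |y| := by
    rw [xiKernel_of_nonneg (abs_nonneg x) (abs_nonneg y)]
    split_ifs <;> simp
  rw [← h]
  rcases abs_choice x with hx | hx <;> rcases abs_choice y with hy | hy <;> rw [hx, hy] <;>
    simp [xiKernel_neg_left, xiKernel_neg_right]

theorem integral_uniformLaw (f : ℝ → ℝ) :
    ∫ x, f x ∂uniformLaw = 1 / 2 * ∫ x in (-1 : ℝ)..1, f x := by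
  rw [uniformLaw, ProbabilityTheory.cond, integral_smul_measure,
    intervalIntegral.integral_of_le (by norm_num), integral_Icc_eq_integral_Ioc]
  simp [Real.volume_Icc]
  left
  norm_num

theorem ae_uniformLaw {p : ℝ → Prop} (h : ∀ᵐ x, x ∈ Set.Icc (-1 : ℝ) 1 → p x) :
    ∀ᵐ x ∂uniformLaw, p x := by
  have h1 : ∀ᵐ x ∂(volume.restrict (Set.Icc (-1 : ℝ) 1)), p x :=
    (ae_restrict_iff' measurableSet_Icc).2 h
  exact Measure.ae_smul_measure h1 _

theorem integral_uniformLaw_comp_abs (f : ℝ → ℝ) :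
    ∫ x, f |x| ∂uniformLaw = ∫ x in (0 : ℝ)..1, f x := by
  have h := integral_comp_abs (f := (Set.Iic (1 : ℝ)).indicator f)
  have h1 : ∀ x : ℝ, (Set.Iic (1 : ℝ)).indicator f |x|
      = (Set.Icc (-1 : ℝ) 1).indicator (fun x => f |x|) x := by
    intro x
    simp only [Set.indicator, Set.mem_Iic, Set.mem_Icc, abs_le]
  simp_rw [h1] at h
  rw [integral_indicator measurableSet_Icc, integral_Icc_eq_integral_Ioc,
    ← intervalIntegral.integral_of_le (by norm_num), setIntegral_indicator measurableSet_Iic,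
    Set.Ioi_inter_Iic, ← intervalIntegral.integral_of_le (by norm_num)] at h
  rw [integral_uniformLaw, h]
  ring

theorem integral_uniformLaw_odd {f : ℝ → ℝ} (hf : ∀ x, f (-x) = -f x) :
    ∫ x, f x ∂uniformLaw = 0 := by
  rw [integral_uniformLaw]
  have h := intervalIntegral.integral_comp_neg (a := -1) (b := 1) f
  simp_rw [hf] at h
  rw [intervalIntegral.integral_neg, neg_neg] at h
  linarith

/-! ### Eigenvectors, symmetry, and existence of a dominant eigenvalue. -/

theorem coeFn_opQ (μ : Measure ℝ) [IsFiniteMeasure μ] (t : ℝ) (v : Lp ℝ 2 μ) :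
    opQ μ t v =ᵐ[μ] fun x => ∫ y, xiKernel t x y * v y ∂μ :=
  (memLp_xiKernel_integral μ t v).coeFn_toLp

theorem ae_eq_of_mem_eigenspace {μ : Measure ℝ} [IsFiniteMeasure μ] {t ν : ℝ} {v : Lp ℝ 2 μ}
    (h : v ∈ Module.End.eigenspace (opQ μ t) ν) :
    ∀ᵐ x ∂μ, ∫ y, xiKernel t x y * v y ∂μ = ν * v x := by
  rw [Module.End.mem_eigenspace_iff] at h
  have h1 := coeFn_opQ μ t v
  rw [h] at h1
  filter_upwards [h1, Lp.coeFn_smul ν v] with x hx hx'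
  rw [← hx, hx', Pi.smul_apply, smul_eq_mul]

theorem hasEigenvalue_opQ_of_ae_eq {μ : Measure ℝ} [IsFiniteMeasure μ] {t ν : ℝ} {f : ℝ → ℝ}
    (hf : MemLp f 2 μ) (h0 : ¬ f =ᵐ[μ] 0)
    (h : ∀ᵐ x ∂μ, ∫ y, xiKernel t x y * f y ∂μ = ν * f x) :
    (opQ μ t).HasEigenvalue ν := by
  refine Module.End.hasEigenvalue_of_hasEigenvector (x := hf.toLp f) ⟨?_, ?_⟩
  · rw [Module.End.mem_eigenspace_iff]
    refine Lp.ext ?_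
    filter_upwards [h, hf.coeFn_toLp, coeFn_opQ μ t (hf.toLp f),
      Lp.coeFn_smul ν (hf.toLp f)] with x hx h1 h2 h3
    rw [h2, h3, Pi.smul_apply, h1, smul_eq_mul, ← hx]
    refine integral_congr_ae ?_
    filter_upwards [hf.coeFn_toLp] with y hy
    rw [hy]
  · intro h1
    exact h0 (hf.coeFn_toLp.symm.trans (by rw [h1]; exact Lp.coeFn_zero _ _ _))

theorem integrable_xiKernel_mul_prod {μ : Measure ℝ} [IsFiniteMeasure μ] (t : ℝ) {f g : ℝ → ℝ}
    (hf : Integrable f μ) (hg : Integrable g μ) :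
    Integrable (fun p : ℝ × ℝ => xiKernel t p.1 p.2 * (f p.1 * g p.2)) (μ.prod μ) :=
  (hf.mul_prod hg).bdd_mul (measurable_xiKernel t).aestronglyMeasurable
    (Filter.Eventually.of_forall fun p => norm_xiKernel_le t p.1 p.2)

theorem integrable_coeFn_Lp_two {μ : Measure ℝ} [IsFiniteMeasure μ] (v : Lp ℝ 2 μ) :
    Integrable (fun y => v y) μ :=
  (Lp.memLp v).integrable (by norm_num)

/-- Fubini and symmetry of the kernel; it serves to make eigenvectors of distinct eigenvalues
orthogonal. -/
theorem isSymmetric_opQ (μ : Measure ℝ) [IsFiniteMeasure μ] (t : ℝ) :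
    (opQ μ t).IsSymmetric := by
  intro v w
  rw [L2.inner_def, L2.inner_def]
  have h1 : ∫ x, inner ℝ (opQ μ t v x) (w x) ∂μ
      = ∫ x, ∫ y, xiKernel t x y * (w x * v y) ∂μ ∂μ := by
    refine integral_congr_ae ?_
    filter_upwards [coeFn_opQ μ t v] with x hx
    rw [hx, real_inner_eq_re_inner, RCLike.inner_apply, conj_trivial, ← integral_const_mul]
    simp only [RCLike.re_to_real]
    refine integral_congr_ae (Filter.Eventually.of_forall fun y => ?_)
    ring
  have h2 : ∫ x, inner ℝ (v x) (opQ μ t w x) ∂μ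
      = ∫ y, ∫ x, xiKernel t x y * (w x * v y) ∂μ ∂μ := by
    refine integral_congr_ae ?_
    filter_upwards [coeFn_opQ μ t w] with x hx
    rw [hx, real_inner_eq_re_inner, RCLike.inner_apply, conj_trivial, ← integral_mul_const]
    simp only [RCLike.re_to_real]
    refine integral_congr_ae (Filter.Eventually.of_forall fun y => ?_)
    simp only [xiKernel_comm t x y]
    ring
  rw [h1, h2]
  exact integral_integral_swap
    (integrable_xiKernel_mul_prod t (integrable_coeFn_Lp_two w) (integrable_coeFn_Lp_two v))

/-- Oddness of the kernel in `y` kills constants. This supplies an eigenvalue even when no nonzero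
one exists. -/
theorem hasEigenvalue_opQ_uniformLaw_zero (t : ℝ) : (opQ uniformLaw t).HasEigenvalue 0 := by
  refine hasEigenvalue_opQ_of_ae_eq (f := fun _ => 1) (memLp_const 1) ?_ ?_
  · intro h
    have h1 := integral_congr_ae h
    simp at h1
  · refine Filter.Eventually.of_forall fun x => ?_
    rw [zero_mul]
    exact integral_uniformLaw_odd fun y => by rw [xiKernel_neg_right, neg_mul]

theorem memLp_xiKernel_section (μ : Measure ℝ) [IsFiniteMeasure μ] (t x : ℝ) :
    MemLp (fun y => xiKernel t x y) 2 μ :=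
  MemLp.of_bound ((measurable_xiKernel t).comp measurable_prodMk_left).aestronglyMeasurable 1
    (Filter.Eventually.of_forall fun y => norm_xiKernel_le t x y)

theorem norm_xiKernel_section_le (μ : Measure ℝ) [IsProbabilityMeasure μ] (t x : ℝ) :
    ‖(memLp_xiKernel_section μ t x).toLp _‖ ≤ 1 := by
  have h := Lp.norm_le_of_ae_bound (f := (memLp_xiKernel_section μ t x).toLp _) zero_le_one
    (by
      filter_upwards [(memLp_xiKernel_section μ t x).coeFn_toLp] with y hy
      rw [hy]
      exact norm_xiKernel_le t x y)
  simpa [measureUnivNNReal] using h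

/-- By Bessel's inequality for the sections of the kernel, the squares of finitely many distinct
eigenvalues sum to at most one. -/
theorem sum_sq_eigenvalues_opQ_le_one (μ : Measure ℝ) [IsProbabilityMeasure μ] (t : ℝ)
    (s : Finset ℝ) (hs : ∀ ν ∈ s, (opQ μ t).HasEigenvalue ν) : ∑ ν ∈ s, ν ^ 2 ≤ 1 := by
  have hex : ∀ ν : s, ∃ e : Lp ℝ 2 μ, e ∈ Module.End.eigenspace (opQ μ t) (ν : ℝ) ∧ ‖e‖ = 1 := by
    intro ν
    obtain ⟨v, hv, hv0⟩ := (hs ν ν.2).exists_hasEigenvector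
    refine ⟨(‖v‖⁻¹ : ℝ) • v, Submodule.smul_mem _ _ hv, ?_⟩
    rw [norm_smul, norm_inv, norm_norm, inv_mul_cancel₀ (norm_ne_zero_iff.2 hv0)]
  choose e he he1 using hex
  have hon : Orthonormal ℝ e := by
    refine ⟨he1, fun i j hij => ?_⟩
    have h := (isSymmetric_opQ μ t).orthogonalFamily_eigenspaces
      (fun h : (i : ℝ) = j => hij (Subtype.ext h)) ⟨e i, he i⟩ ⟨e j, he j⟩
    simpa using h
  -- The Fourier coefficient of the section `ξ(x, ·)` along `e i` is `i * e i x`, and the section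
  -- has norm at most one. Integrating Bessel's inequality over `x` then removes the eigenvectors.
  have hpt : ∀ᵐ x ∂μ, ∑ i : s, (i : ℝ) ^ 2 * (e i x * e i x) ≤ 1 := by
    have hall : ∀ᵐ x ∂μ, ∀ i : s, ∫ y, xiKernel t x y * e i y ∂μ = i * e i x :=
      ae_all_iff.2 fun i => ae_eq_of_mem_eigenspace (he i)
    filter_upwards [hall] with x hx
    have hb := hon.sum_inner_products_le ((memLp_xiKernel_section μ t x).toLp _)
      (s := Finset.univ)
    have hn : ‖(memLp_xiKernel_section μ t x).toLp _‖ ^ 2 ≤ 1 :=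
      pow_le_one₀ (norm_nonneg _) (norm_xiKernel_section_le μ t x)
    refine le_trans (le_of_eq (Finset.sum_congr rfl fun i _ => ?_)) (hb.trans hn)
    have hi : inner ℝ (e i) ((memLp_xiKernel_section μ t x).toLp _) = i * e i x := by
      rw [L2.inner_def, ← hx i]
      refine integral_congr_ae ?_
      filter_upwards [(memLp_xiKernel_section μ t x).coeFn_toLp] with y hy
      rw [hy, real_inner_eq_re_inner, RCLike.inner_apply, conj_trivial]
      simp
    rw [hi, Real.norm_eq_abs, sq_abs]
    ring
  have hint : ∀ i : s, Integrable (fun x => (i : ℝ) ^ 2 * (e i x * e i x)) μ := fun i => by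
    simpa [← pow_two] using (L2.integrable_inner (𝕜 := ℝ) (e i) (e i)).const_mul ((i : ℝ) ^ 2)
  have h1 := integral_mono_ae (integrable_finsetSum Finset.univ fun i _ => hint i)
    (integrable_const (1 : ℝ)) hpt
  rw [integral_finsetSum _ fun i _ => hint i] at h1
  have h2 : ∀ i : s, ∫ x, (i : ℝ) ^ 2 * (e i x * e i x) ∂μ = (i : ℝ) ^ 2 := by
    intro i
    have h3 : inner ℝ (e i) (e i) = (1 : ℝ) := by
      rw [real_inner_self_eq_norm_sq, he1, one_pow]
    rw [L2.inner_def] at h3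
    rw [integral_const_mul]
    simp only [RCLike.inner_apply, conj_trivial] at h3
    rw [h3, mul_one]
  simp_rw [h2] at h1
  rw [Finset.sum_coe_sort s (fun ν => ν ^ 2)] at h1
  simpa using h1

theorem exists_isDominantEigenvalue_opQ (μ : Measure ℝ) [IsProbabilityMeasure μ] (t : ℝ)
    (h0 : (opQ μ t).HasEigenvalue 0) : ∃ ν, IsDominantEigenvalue (opQ μ t) ν := by
  by_cases hne : ∃ ν₀, ν₀ ≠ 0 ∧ (opQ μ t).HasEigenvalue ν₀
  · obtain ⟨ν₀, hν0, hν⟩ := hne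
    set S : Set ℝ := {ν | (opQ μ t).HasEigenvalue ν ∧ |ν₀| ≤ |ν|} with hS
    have hfin : S.Finite := by
      by_contra hinf
      obtain ⟨n, hn⟩ := exists_nat_gt (1 / ν₀ ^ 2)
      obtain ⟨s, hsS, hsc⟩ := (Set.not_finite.1 hinf).exists_subset_card_eq n
      have h1 := sum_sq_eigenvalues_opQ_le_one μ t s fun ν h => (hsS h).1
      have h2 : ∑ ν ∈ s, ν₀ ^ 2 ≤ ∑ ν ∈ s, ν ^ 2 :=
        Finset.sum_le_sum fun ν h => sq_le_sq.2 (hsS h).2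
      rw [Finset.sum_const, hsc, nsmul_eq_mul] at h2
      have h3 : 0 < ν₀ ^ 2 := by positivity
      rw [div_lt_iff₀ h3] at hn
      linarith
    obtain ⟨ν, hνS, hmax⟩ := Set.exists_max_image S (fun ν => |ν|) hfin ⟨ν₀, hν, le_rfl⟩
    refine ⟨ν, hνS.1, fun ν' h' => ?_⟩
    rcases le_total |ν₀| |ν'| with h | h
    · exact hmax ν' ⟨h', h⟩
    · exact h.trans hνS.2
  · push Not at hne
    refine ⟨0, h0, fun ν' h' => ?_⟩
    by_contra h
    exact hne ν' (fun h1 => h (by rw [h1])) h'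

/-! ### The Schur test and the window form of the kernel. -/

theorem integrable_uniformLaw_comp_abs {h : ℝ → ℝ} (hi : IntervalIntegrable h volume 0 1) :
    Integrable (fun x => h |x|) uniformLaw := by
  have h1 : IntervalIntegrable (fun x => h |x|) volume 0 1 := by
    refine hi.congr fun x hx => ?_
    rw [Set.uIoc_of_le zero_le_one] at hx
    simp only [abs_of_pos hx.1]
  have h2 : IntervalIntegrable (fun x => h |x|) volume (-1) 0 := by
    have h3 := IntervalIntegrable.iff_comp_neg (by finiteness) |>.1 h1
    simp only [abs_neg, neg_zero] at h3
    exact h3.symm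
  have h4 := h2.trans h1
  rw [intervalIntegrable_iff_integrableOn_Icc_of_le (by norm_num)] at h4
  exact Integrable.smul_measure h4 (by simp)

/-- A Schur test: a positive supersolution for the nonnegative kernel `|ξ|` on `[0, 1]` bounds all
eigenvalues. -/
theorem abs_eigenvalue_opQ_le {t ν k : ℝ} {h : ℝ → ℝ} (hi : IntervalIntegrable h volume 0 1)
    (hpos : ∀ x ∈ Set.Ioc (0 : ℝ) 1, 0 < h x)
    (hK : ∀ y ∈ Set.Icc (0 : ℝ) 1, ∫ x in (0 : ℝ)..1, xiKernel t x y * h x ≤ k * h y)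
    (hν : (opQ uniformLaw t).HasEigenvalue ν) : |ν| ≤ k := by
  rcases eq_or_ne ν 0 with rfl | h0
  · rw [abs_zero]
    refine nonneg_of_mul_nonneg_left (le_trans ?_ (hK 1 ⟨zero_le_one, le_rfl⟩))
      (hpos 1 ⟨zero_lt_one, le_rfl⟩)
    rw [intervalIntegral.integral_of_le zero_le_one]
    refine setIntegral_nonneg measurableSet_Ioc fun x hx => ?_
    rw [xiKernel_of_nonneg hx.1.le zero_le_one]
    have := hpos x hx
    split_ifs <;> simp [this.le]
  obtain ⟨v, hv, hv0⟩ := hν.exists_hasEigenvector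
  have hg := integrable_uniformLaw_comp_abs hi
  have hF : Integrable (fun x => |v x|) uniformLaw := (integrable_coeFn_Lp_two v).abs
  have hgpos : ∀ᵐ x ∂uniformLaw, 0 < h |x| := by
    refine ae_uniformLaw ?_
    filter_upwards [Measure.ae_ne volume (0 : ℝ)] with x hx0 hx
    exact hpos _ ⟨abs_pos.2 hx0, abs_le.2 hx⟩
  have hprod : Integrable (fun p : ℝ × ℝ => |xiKernel t p.1 p.2| * (h |p.1| * |v p.2|))
      (uniformLaw.prod uniformLaw) :=
    (hg.mul_prod hF).bdd_mul (measurable_xiKernel t).norm.aestronglyMeasurable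
      (c := 1) (Filter.Eventually.of_forall fun p => by
        rw [Real.norm_eq_abs, abs_abs]
        exact norm_xiKernel_le t p.1 p.2)
  have hpt : ∀ᵐ x ∂uniformLaw, |ν| * |v x| ≤ ∫ y, |xiKernel t x y| * |v y| ∂uniformLaw := by
    filter_upwards [ae_eq_of_mem_eigenspace hv] with x hx
    rw [← abs_mul, ← hx]
    simp_rw [← abs_mul]
    exact abs_integral_le_integral_abs
  have hsec : ∀ᵐ y ∂uniformLaw, ∫ x, |xiKernel t x y| * (h |x| * |v y|) ∂uniformLaw
      ≤ k * (h |y| * |v y|) := by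
    refine ae_uniformLaw (Filter.Eventually.of_forall fun y hy => ?_)
    have h1 := hK |y| ⟨abs_nonneg y, abs_le.2 hy⟩
    rw [← integral_uniformLaw_comp_abs fun x => xiKernel t x |y| * h x] at h1
    simp_rw [← abs_xiKernel] at h1
    simp_rw [← mul_assoc]
    rw [integral_mul_const]
    exact mul_le_mul_of_nonneg_right h1 (abs_nonneg _)
  -- Since `h` is only integrable, `v` has to be bounded: for `ν ≠ 0` the eigenvalue equation gives
  -- `|v| ≤ |ν|⁻¹ ∫ |v|` almost everywhere.
  have hFg : Integrable (fun x => h |x| * |v x|) uniformLaw := by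
    refine hg.mul_bdd hF.aestronglyMeasurable
      (c := |ν|⁻¹ * ∫ y, |v y| ∂uniformLaw) ?_
    filter_upwards [hpt] with x hx
    have h2 : ∫ y, |xiKernel t x y| * |v y| ∂uniformLaw ≤ ∫ y, |v y| ∂uniformLaw := by
      refine integral_mono_of_nonneg (Filter.Eventually.of_forall fun y => by positivity) hF
        (Filter.Eventually.of_forall fun y => ?_)
      exact mul_le_of_le_one_left (abs_nonneg _) (norm_xiKernel_le t x y)
    rw [Real.norm_eq_abs, abs_abs, inv_mul_eq_div, le_div_iff₀ (abs_pos.2 h0), mul_comm]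
    exact hx.trans h2
  -- Pair `|ν| |v| ≤ ∫ |ξ| |v|` with `h`, move the kernel onto `h` by Fubini, and apply the
  -- supersolution inequality.
  have hle : |ν| * ∫ x, h |x| * |v x| ∂uniformLaw ≤ k * ∫ x, h |x| * |v x| ∂uniformLaw := by
    rw [← integral_const_mul, ← integral_const_mul]
    calc ∫ x, |ν| * (h |x| * |v x|) ∂uniformLaw
        ≤ ∫ x, ∫ y, |xiKernel t x y| * (h |x| * |v y|) ∂uniformLaw ∂uniformLaw := by
          refine integral_mono_ae (hFg.const_mul _) hprod.integral_prod_left ?_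
          filter_upwards [hpt, hgpos] with x hx hx'
          have h3 := mul_le_mul_of_nonneg_left hx hx'.le
          rw [← integral_const_mul] at h3
          calc |ν| * (h |x| * |v x|) = h |x| * (|ν| * |v x|) := by ring
            _ ≤ _ := h3
            _ = _ := by
              refine integral_congr_ae (Filter.Eventually.of_forall fun y => ?_)
              ring
      _ = ∫ y, ∫ x, |xiKernel t x y| * (h |x| * |v y|) ∂uniformLaw ∂uniformLaw :=
          integral_integral_swap hprod
      _ ≤ ∫ y, k * (h |y| * |v y|) ∂uniformLaw :=
          integral_mono_ae hprod.integral_prod_right (hFg.const_mul _) hsec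
  refine le_of_mul_le_mul_right hle ?_
  have hnn : 0 ≤ᵐ[uniformLaw] fun x => h |x| * |v x| := by
    filter_upwards [hgpos] with x hx
    exact mul_nonneg hx.le (abs_nonneg _)
  refine lt_of_le_of_ne (integral_nonneg_of_ae hnn) fun h2 => hv0 ?_
  have h1 := (integral_eq_zero_iff_of_nonneg_ae hnn hFg).1 h2.symm
  rw [Lp.eq_zero_iff_ae_eq_zero]
  filter_upwards [h1, hgpos] with x hx hx'
  exact abs_eq_zero.1 ((mul_eq_zero.1 hx).resolve_left hx'.ne')

theorem setIntegral_xiKernel_eq {t y : ℝ} (ht : t ∈ Set.Icc (0 : ℝ) 1)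
    (hy : y ∈ Set.Icc (0 : ℝ) 1) (h : ℝ → ℝ) :
    ∫ x in (0 : ℝ)..1, xiKernel t x y * h x = ∫ x in |y - t|..min 1 (y + t), h x := by
  obtain ⟨ht0, ht1⟩ := ht
  obtain ⟨hy0, hy1⟩ := hy
  have hle : |y - t| ≤ min 1 (y + t) :=
    le_min (abs_le.2 ⟨by linarith, by linarith⟩) (abs_le.2 ⟨by linarith, by linarith⟩)
  rw [intervalIntegral.integral_of_le zero_le_one, intervalIntegral.integral_of_le hle,
    ← integral_indicator measurableSet_Ioc, ← integral_indicator measurableSet_Ioc]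
  refine integral_congr_ae ?_
  filter_upwards [Measure.ae_ne volume (y + t), Measure.ae_ne volume (|y - t|)] with x h1 h2
  by_cases hx : x ∈ Set.Ioc |y - t| (min 1 (y + t))
  · rw [Set.indicator_of_mem hx]
    have hx0 : 0 < x := (abs_nonneg _).trans_lt hx.1
    have hx1 : x ≤ 1 := hx.2.trans (min_le_left _ _)
    have hx2 : x < y + t := lt_of_le_of_ne (hx.2.trans (min_le_right _ _)) h1
    have hx3 := abs_lt.1 hx.1
    rw [Set.indicator_of_mem (show x ∈ Set.Ioc (0 : ℝ) 1 from ⟨hx0, hx1⟩), xiKernel_of_nonneg hx0.le hy0, if_pos, one_mul]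
    exact ⟨abs_lt.2 ⟨by linarith, by linarith⟩, by linarith⟩
  · rw [Set.indicator_of_notMem hx]
    by_cases hx' : x ∈ Set.Ioc (0 : ℝ) 1
    · rw [Set.indicator_of_mem hx', xiKernel_of_nonneg hx'.1.le hy0, if_neg, zero_mul]
      rintro ⟨h3, h4⟩
      have h5 := abs_lt.1 h3
      refine hx ⟨lt_of_le_of_ne (abs_le.2 ⟨by linarith, by linarith⟩) h2.symm,
        le_min hx'.2 (by linarith)⟩
    · rw [Set.indicator_of_notMem hx']

theorem abs_eigenvalue_opQ_le_of_supersolution {t ν k : ℝ} (ht : t ∈ Set.Icc (0 : ℝ) 1)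
    {h : ℝ → ℝ} (hi : IntervalIntegrable h volume 0 1)
    (hpos : ∀ x ∈ Set.Ioc (0 : ℝ) 1, 0 < h x)
    (hK : ∀ y ∈ Set.Icc (0 : ℝ) 1, ∫ x in |y - t|..min 1 (y + t), h x ≤ k * h y)
    (hν : (opQ uniformLaw t).HasEigenvalue ν) : |ν| ≤ k :=
  abs_eigenvalue_opQ_le hi hpos
    (fun y hy => (setIntegral_xiKernel_eq ht hy h).trans_le (hK y hy)) hν

/-- Beyond `t = 1` the condition `|x - y| < t` no longer restricts anything on the support, while `t
≤ x + y` only becomes harder to satisfy. -/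
theorem xiKernel_le_of_one_le {t x y : ℝ} (ht : 1 ≤ t) (hx : x ∈ Set.Icc (0 : ℝ) 1)
    (hy : y ∈ Set.Icc (0 : ℝ) 1) : xiKernel t x y ≤ xiKernel 1 x y := by
  rw [xiKernel_of_nonneg hx.1 hy.1, xiKernel_of_nonneg hx.1 hy.1]
  rcases ht.eq_or_lt with rfl | ht
  · exact le_rfl
  by_cases h : |x - y| < t ∧ t ≤ x + y
  · rw [if_pos h, if_pos ⟨abs_lt.2 ⟨by linarith [hx.1, hy.2, h.2], by linarith [hx.2, hy.1, h.2]⟩, by linarith [h.2]⟩]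
  · rw [if_neg h]
    split_ifs <;> norm_num

theorem abs_eigenvalue_opQ_le_of_one_le {t ν k : ℝ} (ht : 1 ≤ t)
    {h : ℝ → ℝ} (hi : IntervalIntegrable h volume 0 1)
    (hpos : ∀ x ∈ Set.Ioc (0 : ℝ) 1, 0 < h x)
    (hK : ∀ y ∈ Set.Icc (0 : ℝ) 1, ∫ x in |y - 1|..min 1 (y + 1), h x ≤ k * h y)
    (hν : (opQ uniformLaw t).HasEigenvalue ν) : |ν| ≤ k := by
  have hint : ∀ s y, IntervalIntegrable (fun x => xiKernel s x y * h x) volume 0 1 := by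
    intro s y
    rw [intervalIntegrable_iff] at hi ⊢
    exact hi.bdd_mul (c := 1) ((measurable_xiKernel s).comp measurable_prodMk_right).aestronglyMeasurable
      (Filter.Eventually.of_forall fun x => norm_xiKernel_le s x y)
  refine abs_eigenvalue_opQ_le hi hpos (fun y hy => le_trans ?_ (hK y hy)) hν
  rw [← setIntegral_xiKernel_eq ⟨zero_le_one, le_rfl⟩ hy h]
  refine intervalIntegral.integral_mono_on_of_le_Ioo zero_le_one (hint t y) (hint 1 y)
    fun x hx => ?_
  exact mul_le_mul_of_nonneg_right (xiKernel_le_of_one_le ht ⟨hx.1.le, hx.2.le⟩ hy)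
    (hpos x ⟨hx.1, hx.2.le⟩).le

/-! ### The critical constants and their numerical bounds. -/

noncomputable section

/-- The angle `arctan (1 / √2)`. -/
def criticalAngle : ℝ := Real.arctan (1 / Real.sqrt 2)

/-- The value `(√2 / 3) / arctan (1 / √2)` of the dominant eigenvalue at `t = 2 / 3`. -/
def criticalValue : ℝ := Real.sqrt 2 / 3 * criticalAngle⁻¹

end

theorem criticalAngle_pos : 0 < criticalAngle :=
  Real.arctan_pos.2 (by positivity)

theorem criticalAngle_lt_pi_div_two : criticalAngle < Real.pi / 2 := Real.arctan_lt_pi_div_two _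

theorem cos_criticalAngle : Real.cos criticalAngle = Real.sqrt 2 / Real.sqrt 3 := by
  rw [criticalAngle, Real.cos_arctan, div_pow, Real.sq_sqrt (by norm_num), one_pow,
    show (1 : ℝ) + 1 / 2 = 3 / 2 by norm_num, Real.sqrt_div (by norm_num), one_div_div]

theorem sin_criticalAngle : Real.sin criticalAngle = 1 / Real.sqrt 3 := by
  have h := Real.tan_mul_cos (x := criticalAngle) (by rw [cos_criticalAngle]; positivity)
  rw [← h, cos_criticalAngle, criticalAngle, Real.tan_arctan]
  field_simp

theorem criticalAngle_le : criticalAngle ≤ 617 / 1000 := by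
  by_contra! h
  have h1 : Real.sin (617 / 1000) < Real.sin criticalAngle :=
    Real.sin_lt_sin_of_lt_of_le_pi_div_two (by linarith [Real.pi_gt_three])
      criticalAngle_lt_pi_div_two.le h
  have h2 := Real.sin_gt_sub_cube (x := 617 / 1000) (by norm_num)
  have h3 : (1.732 : ℝ) ≤ Real.sqrt 3 := Real.le_sqrt_of_sq_le (by norm_num)
  rw [sin_criticalAngle, lt_div_iff₀ (by positivity)] at h1
  nlinarith

theorem criticalValue_mul : criticalValue * (3 * criticalAngle) = Real.sqrt 2 := by
  have := criticalAngle_pos.ne'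
  rw [criticalValue]
  field_simp

/-- Sharp enough to beat both `2/3` and the value `2 sin (2π/5) / (4π/5) ≈ 0.757` of the sine test
function. -/
theorem criticalValue_ge : 0.764 ≤ criticalValue := by
  have h : (1.41421 : ℝ) ≤ Real.sqrt 2 := Real.le_sqrt_of_sq_le (by norm_num)
  have h1 := criticalValue_mul
  have h2 := criticalAngle_le
  have h3 := criticalAngle_pos
  nlinarith

theorem criticalValue_pos : 0 < criticalValue := by linarith [criticalValue_ge]

/-! ### Upper bound for `t ≤ 1/2`. -/

theorem integral_sin_const_mul {w : ℝ} (hw : w ≠ 0) (a b : ℝ) :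
    ∫ x in a..b, Real.sin (w * x) = (Real.cos (w * a) - Real.cos (w * b)) / w := by
  rw [intervalIntegral.integral_comp_mul_left (fun x => Real.sin x) hw, integral_sin, smul_eq_mul]
  ring

theorem cos_mul_abs (w x : ℝ) : Real.cos (w * |x|) = Real.cos (w * x) := by
  rcases abs_choice x with h | h <;> rw [h]
  rw [mul_neg, Real.cos_neg]

theorem sin_two_pi_div_five_le : 2 * Real.sin (2 * Real.pi / 5) ≤ criticalValue * (4 * Real.pi / 5) := by
  have h1 : Real.sin (2 * Real.pi / 5) = Real.cos (Real.pi / 10) := by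
    rw [← Real.cos_pi_div_two_sub]
    congr 1
    ring
  have hp := Real.pi_gt_d2
  have hp' := Real.pi_lt_d2
  have h2 := Real.cos_bound (x := Real.pi / 10) (abs_le.2 ⟨by linarith, by linarith⟩)
  have h3 := (abs_le.1 h2).2
  rw [abs_of_pos (by positivity)] at h3
  have h4 : (Real.pi / 10) ^ 4 ≤ (0.315 : ℝ) ^ 4 := pow_le_pow_left₀ (by positivity) (by linarith) 4
  have h5 : (0.314 : ℝ) ^ 2 ≤ (Real.pi / 10) ^ 2 := pow_le_pow_left₀ (by positivity) (by linarith) 2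
  have h6 := criticalValue_ge
  rw [h1]
  norm_num at h4 h5
  nlinarith

theorem abs_eigenvalue_opQ_le_of_le_half {t ν : ℝ} (ht : t ∈ Set.Icc (0 : ℝ) (1 / 2))
    (hν : (opQ uniformLaw t).HasEigenvalue ν) : |ν| ≤ criticalValue := by
  obtain ⟨ht0, ht1⟩ := ht
  have hpi := Real.pi_pos
  -- The largest frequency for which truncating the window at `1` does no harm: `(1 + y + t) / 2 ≤
  -- 5/4`, and `w * (5/4) = π`.
  set w : ℝ := 4 * Real.pi / 5 with hw
  have hw0 : 0 < w := by positivity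
  have hk : 2 * Real.sin (w * t) ≤ criticalValue * w := by
    refine le_trans ?_ sin_two_pi_div_five_le
    have : Real.sin (w * t) ≤ Real.sin (2 * Real.pi / 5) :=
      Real.sin_le_sin_of_le_of_le_pi_div_two (by nlinarith) (by linarith) (by nlinarith)
    linarith
  have hfull : ∀ y ∈ Set.Icc (0 : ℝ) 1,
      Real.cos (w * (y - t)) - Real.cos (w * (y + t)) ≤ criticalValue * w * Real.sin (w * y) := by
    intro y hy
    have h1 : 0 ≤ Real.sin (w * y) :=
      Real.sin_nonneg_of_nonneg_of_le_pi (by have := hy.1; positivity) (by nlinarith [hy.2])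
    rw [mul_sub, mul_add, Real.cos_sub, Real.cos_add]
    nlinarith
  refine abs_eigenvalue_opQ_le_of_supersolution (h := fun x => Real.sin (w * x))
    ⟨ht0, by linarith⟩ (Continuous.intervalIntegrable (by fun_prop) _ _)
    (fun x hx => Real.sin_pos_of_pos_of_lt_pi (by have := hx.1; positivity) (by nlinarith [hx.2]))
    (fun y hy => ?_) hν
  rw [integral_sin_const_mul hw0.ne', cos_mul_abs, div_le_iff₀ hw0]
  -- Truncation only decreases the integral. The argument `w * (y + t)` may exceed `π`, so
  -- monotonicity of cosine is replaced by the product formula, whose half-sum stays at most `π`.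
  have h1 : Real.cos (w * (y + t)) ≤ Real.cos (w * min 1 (y + t)) := by
    rcases le_total (y + t) 1 with h | h
    · rw [min_eq_right h]
    rw [min_eq_left h, ← sub_nonneg, Real.cos_sub_cos]
    have h2 : 0 ≤ Real.sin ((w * 1 + w * (y + t)) / 2) :=
      Real.sin_nonneg_of_nonneg_of_le_pi (by nlinarith) (by nlinarith [hy.2])
    have h3 : 0 ≤ Real.sin ((w * (y + t) - w * 1) / 2) :=
      Real.sin_nonneg_of_nonneg_of_le_pi (by nlinarith) (by nlinarith [hy.2])
    rw [show (w * 1 - w * (y + t)) / 2 = -((w * (y + t) - w * 1) / 2) by ring, Real.sin_neg]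
    nlinarith [mul_nonneg h2 h3]
  have := hfull y hy
  linarith

/-! ### Supersolutions for `2/3 ≤ t ≤ 1`. -/

theorem le_of_hasDerivAt_nonneg {f f' : ℝ → ℝ} {a b : ℝ} (hab : a ≤ b)
    (hf : ∀ x, HasDerivAt f (f' x) x) (h : ∀ x ∈ Set.Icc a b, 0 ≤ f' x) : f a ≤ f b := by
  refine monotoneOn_of_deriv_nonneg (convex_Icc a b)
    (fun x _ => (hf x).continuousAt.continuousWithinAt)
    (fun x _ => (hf x).differentiableAt.differentiableWithinAt)
    (fun x hx => ?_) ⟨le_rfl, hab⟩ ⟨hab, le_rfl⟩ hab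
  rw [(hf x).deriv]
  exact h x (interior_subset hx)

theorem integral_eq_sub_of_eqOn_Ioo {h g G : ℝ → ℝ} {a b : ℝ} (hab : a ≤ b)
    (he : Set.EqOn h g (Set.Ioo a b)) (hG : ∀ x, HasDerivAt G (g x) x) (hg : Continuous g) :
    IntervalIntegrable h volume a b ∧ ∫ x in a..b, h x = G b - G a := by
  constructor
  · refine (hg.intervalIntegrable a b).congr_uIoo ?_
    rw [Set.uIoo_of_le hab]
    exact he.symm
  · rw [intervalIntegral.integral_congr_Ioo_of_le hab he]
    exact intervalIntegral.integral_eq_sub_of_hasDerivAt (fun x _ => hG x)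
      (hg.intervalIntegrable a b)

theorem sqrt_two_mul_sin_le_cos {θ : ℝ} (h0 : 0 ≤ θ) (h1 : θ ≤ criticalAngle) :
    Real.sqrt 2 * Real.sin θ ≤ Real.cos θ := by
  have h2 := criticalAngle_lt_pi_div_two
  have hs : Real.sin θ ≤ Real.sin criticalAngle :=
    Real.sin_le_sin_of_le_of_le_pi_div_two (by linarith) h2.le h1
  have hc : Real.cos criticalAngle ≤ Real.cos θ :=
    Real.cos_le_cos_of_nonneg_of_le_pi h0 (by linarith) h1
  rw [sin_criticalAngle] at hs
  rw [cos_criticalAngle] at hc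
  calc Real.sqrt 2 * Real.sin θ ≤ Real.sqrt 2 * (1 / Real.sqrt 3) := by gcongr
    _ = Real.sqrt 2 / Real.sqrt 3 := by ring
    _ ≤ _ := hc

/-- Equivalently `√2 tan θ ≤ tan (π / 4 - L)` with `L = 3 / (2 √2) * (arctan (1 / √2) - θ)`. -/
theorem sqrt_two_mul_sin_mul_le {θ : ℝ} (h0 : 0 ≤ θ) (h1 : θ ≤ criticalAngle) {L : ℝ}
    (hL : L = 3 * Real.sqrt 2 / 4 * (criticalAngle - θ)) :
    Real.sin θ * (Real.cos L + Real.sin L) ≤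
      Real.sqrt 2 / 2 * Real.cos θ * (Real.cos L - Real.sin L) := by
  set c := 3 * Real.sqrt 2 / 4 with hc
  have h2 : Real.sqrt 2 ^ 2 = 2 := Real.sq_sqrt (by norm_num)
  have h2pos : 0 < Real.sqrt 2 := by positivity
  set ℓ : ℝ → ℝ := fun x => c * (criticalAngle - x) with hℓ
  have hdℓ : ∀ x, HasDerivAt ℓ (-c) x := fun x => by
    simpa using ((hasDerivAt_id x).const_sub criticalAngle).const_mul c
  -- The difference of the two sides vanishes at `criticalAngle`, where `ℓ = 0`, and is
  -- nondecreasing up to that point, hence nonpositive before it.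
  have hd : ∀ x, HasDerivAt (fun x => Real.sin x * (Real.cos (ℓ x) + Real.sin (ℓ x)) -
      Real.sqrt 2 / 2 * Real.cos x * (Real.cos (ℓ x) - Real.sin (ℓ x)))
      (Real.sqrt 2 / 4 * (Real.sqrt 2 / 2 * Real.cos x * (Real.cos (ℓ x) + Real.sin (ℓ x))
        - Real.sin x * (Real.cos (ℓ x) - Real.sin (ℓ x)))) x := by
    intro x
    have h3 := ((Real.hasDerivAt_sin x).mul ((hdℓ x).cos.add (hdℓ x).sin)).sub
      (((Real.hasDerivAt_cos x).const_mul (Real.sqrt 2 / 2)).mul ((hdℓ x).cos.sub (hdℓ x).sin))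
    refine h3.congr_deriv ?_
    simp only [Pi.add_apply, Pi.sub_apply, hc]
    linear_combination -(Real.cos x * (Real.cos (ℓ x) + Real.sin (ℓ x)) / 2) * h2
  have h3 := le_of_hasDerivAt_nonneg h1 hd fun x hx => ?_
  · simp only [hℓ, sub_self, mul_zero, Real.cos_zero, Real.sin_zero, cos_criticalAngle,
      sin_criticalAngle] at h3
    have h4 : 1 / Real.sqrt 3 * (1 + 0) - Real.sqrt 2 / 2 * (Real.sqrt 2 / Real.sqrt 3) * (1 - 0)
        = (2 - Real.sqrt 2 ^ 2) / (2 * Real.sqrt 3) := by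
      field_simp
      ring
    rw [h4, h2, sub_self, zero_div] at h3
    rw [hL]
    linarith
  · have hx0 : 0 ≤ x := h0.trans hx.1
    have h5 := sqrt_two_mul_sin_le_cos hx0 hx.2
    have h6 := criticalAngle_le
    have h7 : Real.sqrt 2 ≤ 1.42 := Real.sqrt_le_iff.2 ⟨by norm_num, by norm_num⟩
    have hℓ0 : 0 ≤ ℓ x := mul_nonneg (by positivity) (by linarith [hx.2])
    have hℓ1 : ℓ x ≤ 1 := by
      simp only [hℓ, hc]
      nlinarith
    have h8 : 0 ≤ Real.sin (ℓ x) :=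
      Real.sin_nonneg_of_nonneg_of_le_pi hℓ0 (by linarith [Real.pi_gt_three])
    have h9 : 0 ≤ Real.cos (ℓ x) :=
      Real.cos_nonneg_of_neg_pi_div_two_le_of_le (by linarith [Real.pi_gt_three])
        (by linarith [Real.pi_gt_three])
    have h10 : 0 ≤ Real.sin x :=
      Real.sin_nonneg_of_nonneg_of_le_pi hx0 (by linarith [Real.pi_gt_three, hx.2])
    have h11 : Real.sin x ≤ Real.sqrt 2 / 2 * Real.cos x := by
      have := mul_le_mul_of_nonneg_left h5 h2pos.le
      nlinarith
    have h12 := mul_le_mul_of_nonneg_right h11 (add_nonneg h9 h8)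
    have h13 : Real.sin x * (Real.cos (ℓ x) - Real.sin (ℓ x))
        ≤ Real.sin x * (Real.cos (ℓ x) + Real.sin (ℓ x)) :=
      mul_le_mul_of_nonneg_left (by linarith) h10
    have h14 : 0 ≤ Real.sqrt 2 / 2 * Real.cos x * (Real.cos (ℓ x) + Real.sin (ℓ x))
        - Real.sin x * (Real.cos (ℓ x) - Real.sin (ℓ x)) := by linarith
    positivity

theorem hasDerivAt_neg_cos_const_mul (w c x : ℝ) :
    HasDerivAt (fun x => -(c * Real.cos (w * x))) (c * w * Real.sin (w * x)) x := by
  have h := (((hasDerivAt_id x).const_mul w).cos.const_mul c).neg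
  refine h.congr_deriv ?_
  simp only [id]
  ring

theorem hasDerivAt_sin_const_mul_sub (w c t x : ℝ) :
    HasDerivAt (fun x => c * Real.sin (w * (x - t))) (c * w * Real.cos (w * (x - t))) x := by
  have h := ((((hasDerivAt_id x).sub_const t).const_mul w).sin.const_mul c)
  refine h.congr_deriv ?_
  simp only [id]
  ring

/-- In the rescaled variable `u = (x - c) / k`, integrals acquire exactly the factor `k` on the
right of the supersolution inequality. -/
theorem hasDerivAt_comp_sub_div {P p : ℝ → ℝ} (hP : ∀ u, HasDerivAt P (p u) u) {k : ℝ}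
    (hk : k ≠ 0) (c x : ℝ) :
    HasDerivAt (fun x => k * P ((x - c) / k)) (p ((x - c) / k)) x := by
  have h := ((hP ((x - c) / k)).comp x
    (((hasDerivAt_id x).sub_const c).div_const k)).const_mul k
  refine h.congr_deriv ?_
  field_simp

/-- A supersolution with a middle piece proportional to `cos + sin`. -/
theorem exists_supersolution_of_two_thirds_le {t : ℝ} (ht : t ∈ Set.Icc (2 / 3 : ℝ) 1) :
    ∃ h : ℝ → ℝ, IntervalIntegrable h volume 0 1 ∧ (∀ x ∈ Set.Ioc (0 : ℝ) 1, 0 < h x) ∧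
      ∀ y ∈ Set.Icc (0 : ℝ) 1,
        ∫ x in |y - t|..min 1 (y + t), h x ≤ criticalValue * h y := by
  obtain ⟨ht0, ht1⟩ := ht
  set k := criticalValue with hk
  set w := 3 * criticalAngle with hw
  set r := Real.sqrt 2 with hr
  have hr2 : r ^ 2 = 2 := Real.sq_sqrt (by norm_num)
  have hr0 : 0 < r := by positivity
  have hr1 : r ≤ 1.42 := Real.sqrt_le_iff.2 ⟨by norm_num, by norm_num⟩
  have hkw : k * w = r := criticalValue_mul
  have hk0 : 0 < k := criticalValue_pos
  have hw0 : 0 < w := mul_pos (by norm_num) criticalAngle_pos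
  have hang := criticalAngle_le
  have hpi := Real.pi_gt_three
  set θ := w * (1 - t) with hθ
  have hθ0 : 0 ≤ θ := mul_nonneg hw0.le (by linarith)
  have hθ1 : θ ≤ criticalAngle := by
    have := criticalAngle_pos
    rw [hθ, hw]
    nlinarith
  set L := (3 * t / 2 - 1) / k with hL
  have hLθ : L = 3 * r / 4 * (criticalAngle - θ) := by
    rw [hL, div_eq_iff hk0.ne', hθ, hw, show 3 * r / 4 * (criticalAngle
      - 3 * criticalAngle * (1 - t)) * k = 3 / 4 * (t - 2 / 3) * r * (k * (3 * criticalAngle)) by ring,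
      ← hw, hkw]
    linear_combination -(3 / 4 * (t - 2 / 3)) * hr2
  have hL0 : 0 ≤ L := div_nonneg (by linarith) hk0.le
  have hL1 : L ≤ 0.66 := by rw [hLθ]; nlinarith
  have hcs : ∀ u ∈ Set.Icc (-L) L, 0 < Real.cos u + Real.sin u := by
    intro u hu
    have h1 := Real.one_sub_sq_div_two_le_cos (x := u)
    have h2 : |u| ≤ 0.66 := (abs_le.2 hu).trans hL1
    have h3 := (abs_le.1 (Real.abs_sin_le_abs (x := u))).1
    have h4 : u ^ 2 ≤ 0.66 ^ 2 := by
      rw [← sq_abs]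
      exact pow_le_pow_left₀ (abs_nonneg u) h2 2
    norm_num at h4
    linarith
  have hcsL := hcs L ⟨by linarith, le_rfl⟩
  have hcosθ : 0 < Real.cos θ :=
    Real.cos_pos_of_mem_Ioo ⟨by linarith, by linarith [criticalAngle_lt_pi_div_two]⟩
  -- Chosen so that the middle piece meets the cosine piece continuously at `2t - 1`. The
  -- supersolution inequalities on both of these pieces then reduce to `hkey`.
  set A := r / 2 * Real.cos θ / (Real.cos L + Real.sin L) with hA
  have hA0 : 0 < A := by positivity
  have hAL : A * (Real.cos L + Real.sin L) = r / 2 * Real.cos θ := div_mul_cancel₀ _ hcsL.ne'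
  have hkey : Real.sin θ ≤ A * (Real.cos L - Real.sin L) := by
    have h1 := sqrt_two_mul_sin_mul_le hθ0 hθ1 hLθ
    rw [hA, div_mul_eq_mul_div, le_div_iff₀ hcsL]
    exact h1
  set g₂ : ℝ → ℝ := fun u => A * (Real.cos u + Real.sin u) with hg₂
  set G₂ : ℝ → ℝ := fun u => A * (Real.sin u - Real.cos u) with hG₂
  have hdG₂ : ∀ u, HasDerivAt G₂ (g₂ u) u := fun u => by
    refine (((Real.hasDerivAt_sin u).sub (Real.hasDerivAt_cos u)).const_mul A).congr_deriv ?_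
    simp only [hg₂]
    ring
  -- The window of a point of the first piece lies in the third, so these two are matched as an
  -- exact sine-cosine pair. On the middle piece the lower endpoint is the reflection `t - y`, and
  -- `cos + sin` solves the resulting equation `g' (u) = g (-u)`.
  set h : ℝ → ℝ := fun x => if x ≤ 1 - t then Real.sin (w * x) else
    if x < 2 * t - 1 then g₂ ((x - t / 2) / k) else r / 2 * Real.cos (w * (x - t)) with hh
  have hval1 : ∀ x ≤ 1 - t, h x = Real.sin (w * x) := fun x hx => if_pos hx
  have hval2 : ∀ x, 1 - t < x → x < 2 * t - 1 → h x = g₂ ((x - t / 2) / k) := fun x h1 h2 => by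
    simp only [hh, if_neg (not_le.2 h1), if_pos h2]
  have hval3 : ∀ x, 1 - t < x → 2 * t - 1 ≤ x → h x = r / 2 * Real.cos (w * (x - t)) :=
    fun x h1 h2 => by simp only [hh, if_neg (not_le.2 h1), if_neg (not_lt.2 h2)]
  have hI1 : ∀ a b, a ≤ b → b ≤ 1 - t → IntervalIntegrable h volume a b ∧
      ∫ x in a..b, h x = k * (r / 2) * (Real.cos (w * a) - Real.cos (w * b)) := by
    intro a b hab hb
    obtain ⟨h1, h2⟩ := integral_eq_sub_of_eqOn_Ioo (h := h) hab
      (fun x hx => hval1 x (hx.2.le.trans hb)) (G := fun x => -(k * (r / 2) * Real.cos (w * x)))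
      (fun x => (hasDerivAt_neg_cos_const_mul w (k * (r / 2)) x).congr_deriv
        (by linear_combination Real.sin (w * x) * (r / 2 * hkw + hr2 / 2))) (by fun_prop)
    exact ⟨h1, by rw [h2]; ring⟩
  have hI2 : ∀ a b, 1 - t ≤ a → a ≤ b → b ≤ 2 * t - 1 → IntervalIntegrable h volume a b ∧
      ∫ x in a..b, h x = k * G₂ ((b - t / 2) / k) - k * G₂ ((a - t / 2) / k) := by
    intro a b ha hab hb
    exact integral_eq_sub_of_eqOn_Ioo (h := h) hab
      (fun x hx => hval2 x (ha.trans_lt hx.1) (hx.2.trans_le hb))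
      (fun x => hasDerivAt_comp_sub_div hdG₂ hk0.ne' (t / 2) x) (by fun_prop)
  have hI3 : ∀ a b, 2 * t - 1 ≤ a → a ≤ b → IntervalIntegrable h volume a b ∧
      ∫ x in a..b, h x = k / 2 * (Real.sin (w * (b - t)) - Real.sin (w * (a - t))) := by
    intro a b ha hab
    obtain ⟨h1, h2⟩ := integral_eq_sub_of_eqOn_Ioo (h := h) hab
      (fun x hx => hval3 x (by linarith [hx.1]) (ha.trans hx.1.le))
      (G := fun x => k / 2 * Real.sin (w * (x - t)))
      (fun x => (hasDerivAt_sin_const_mul_sub w (k / 2) t x).congr_deriv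
        (by linear_combination Real.cos (w * (x - t)) * (hkw / 2))) (by fun_prop)
    exact ⟨h1, by rw [h2]; ring⟩
  have htop : ∫ x in (2 * t - 1)..1, h x = k * Real.sin θ := by
    rw [(hI3 (2 * t - 1) 1 le_rfl (by linarith)).2,
      show w * (2 * t - 1 - t) = -θ by rw [hθ]; ring, Real.sin_neg]
    ring
  have hLval : (2 * t - 1 - t / 2) / k = L := by rw [hL]; ring
  have hLval' : (1 - t - t / 2) / k = -L := by rw [hL]; ring
  refine ⟨h, ?_, ?_, ?_⟩
  · exact ((hI1 0 (1 - t) (by linarith) le_rfl).1.trans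
      (hI2 (1 - t) (2 * t - 1) le_rfl (by linarith) le_rfl).1).trans
      (hI3 (2 * t - 1) 1 le_rfl (by linarith)).1
  · intro x hx
    rcases le_or_gt x (1 - t) with h1 | h1
    · rw [hval1 x h1]
      refine Real.sin_pos_of_pos_of_lt_pi (mul_pos hw0 hx.1) ?_
      have : w * x ≤ θ := mul_le_mul_of_nonneg_left h1 hw0.le
      linarith
    rcases lt_or_ge x (2 * t - 1) with h2 | h2
    · rw [hval2 x h1 h2]
      refine mul_pos hA0 (hcs _ ⟨?_, ?_⟩)
      · rw [← hLval']
        gcongr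
      · rw [← hLval]
        gcongr
    · rw [hval3 x h1 h2]
      refine mul_pos (by positivity) (Real.cos_pos_of_mem_Ioo ⟨?_, ?_⟩)
      · have : w * (t - x) ≤ θ := mul_le_mul_of_nonneg_left (by linarith) hw0.le
        linarith [criticalAngle_lt_pi_div_two]
      · have : w * (x - t) ≤ θ := mul_le_mul_of_nonneg_left (by linarith [hx.2]) hw0.le
        linarith [criticalAngle_lt_pi_div_two]
  · intro y hy
    rcases le_or_gt y (1 - t) with h1 | h1
    · rw [hval1 y h1, min_eq_right (by linarith), abs_of_nonpos (by linarith [hy.1]), neg_sub,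
        (hI3 (t - y) (y + t) (by linarith) (by linarith [hy.1])).2, add_sub_cancel_right,
        show w * (t - y - t) = -(w * y) by ring, Real.sin_neg]
      exact le_of_eq (by ring)
    have hmin : min 1 (y + t) = 1 := min_eq_left (by linarith)
    rcases lt_or_ge y (2 * t - 1) with h2 | h2
    · rw [hmin, abs_of_nonpos (by linarith), neg_sub, hval2 y h1 h2]
      have hi2 := hI2 (t - y) (2 * t - 1) (by linarith) (by linarith) le_rfl
      rw [← intervalIntegral.integral_add_adjacent_intervals hi2.1
        (hI3 (2 * t - 1) 1 le_rfl (by linarith)).1, hi2.2, htop, hLval,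
        show (t - y - t / 2) / k = -((y - t / 2) / k) by ring]
      simp only [hG₂, hg₂, Real.sin_neg, Real.cos_neg]
      -- The integral is `k` times `g₂ u - A (cos L - sin L) + sin θ`, so `hkey` is exactly what is
      -- needed.
      nlinarith
    · rw [hmin, hval3 y h1 h2]
      have habs : |y - t| ≤ 1 - t := abs_le.2 ⟨by linarith, by linarith [hy.2]⟩
      have hi1 := hI1 |y - t| (1 - t) habs le_rfl
      have hi2 := hI2 (1 - t) (2 * t - 1) le_rfl (by linarith) le_rfl
      rw [← intervalIntegral.integral_add_adjacent_intervals (hi1.1.trans hi2.1)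
        (hI3 (2 * t - 1) 1 le_rfl (by linarith)).1,
        ← intervalIntegral.integral_add_adjacent_intervals hi1.1 hi2.1, hi1.2, hi2.2, htop, hLval,
        hLval', cos_mul_abs, ← hθ]
      simp only [hG₂, Real.sin_neg, Real.cos_neg]
      nlinarith

/-! ### Supersolutions for `1/2 ≤ t < 2/3`. -/

theorem cos_le_quartic {x : ℝ} (hx : 0 ≤ x) : Real.cos x ≤ 1 - x ^ 2 / 2 + x ^ 4 / 24 := by
  have h := le_of_hasDerivAt_nonneg (f := fun x => 1 - x ^ 2 / 2 + x ^ 4 / 24 - Real.cos x)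
    (f' := fun x => Real.sin x - (x - x ^ 3 / 6)) hx (fun x => by
      refine (((((hasDerivAt_pow 2 x).div_const 2).const_sub 1).add
        ((hasDerivAt_pow 4 x).div_const 24)).sub (Real.hasDerivAt_cos x)).congr_deriv ?_
      simp
      ring) (fun x hx => by linarith [Real.sin_ge_sub_cube hx.1])
  simp at h
  linarith

theorem sqrt_two_mul_sin_div_bounds {E : ℝ} (hE0 : 0 < E) :
    ∃ s : ℝ, s * E = Real.sqrt 2 * Real.sin (Real.sqrt 2 * E) ∧
      s ≤ 2 ∧ 2 - 2 * E ^ 2 / 3 ≤ s := by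
  have hr2 : Real.sqrt 2 ^ 2 = 2 := Real.sq_sqrt (by norm_num)
  have hr0 : 0 < Real.sqrt 2 := by positivity
  set r := Real.sqrt 2
  set S := Real.sin (r * E) with hS
  have hy0 : 0 < r * E := by positivity
  -- `s = 2 sin y / y` for `y = √2 E`
  set s := r * S / E with hs
  have hsE : s * E = r * S := div_mul_cancel₀ _ hE0.ne'
  have hs_le : s ≤ 2 := by
    rw [hs, div_le_iff₀ hE0]
    have := mul_le_mul_of_nonneg_left (Real.sin_le hy0.le) hr0.le
    nlinarith
  have hs_ge : 2 - 2 * E ^ 2 / 3 ≤ s := by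
    rw [hs, le_div_iff₀ hE0]
    have := mul_le_mul_of_nonneg_left (Real.sin_ge_sub_cube hy0.le) hr0.le
    have h4 : r * (r * E - (r * E) ^ 3 / 6) = r ^ 2 * E - (r ^ 2) ^ 2 * E ^ 3 / 6 := by ring
    rw [h4, hr2] at this
    nlinarith
  exact ⟨s, hsE, hs_le, hs_ge⟩

theorem cos_sqrt_two_mul_bounds {E : ℝ} (hE0 : 0 ≤ E) :
    Real.cos (Real.sqrt 2 * E) ≤ 1 - E ^ 2 + E ^ 4 / 6 ∧
      1 - E ^ 2 ≤ Real.cos (Real.sqrt 2 * E) := by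
  have hr2 : Real.sqrt 2 ^ 2 = 2 := Real.sq_sqrt (by norm_num)
  set r := Real.sqrt 2
  constructor
  · have h := cos_le_quartic (x := r * E) (by positivity)
    have h4 : 1 - (r * E) ^ 2 / 2 + (r * E) ^ 4 / 24
      = 1 - r ^ 2 * E ^ 2 / 2 + (r ^ 2) ^ 2 * E ^ 4 / 24 := by ring
    rw [h4, hr2] at h
    linarith
  · have h := Real.one_sub_sq_div_two_le_cos (x := r * E)
    rw [mul_pow, hr2] at h
    linarith

/-- The constants of the polynomial comparison functions. -/
theorem exists_polynomial_constants {E a b L s C : ℝ} (hE0 : 0 < E) (hE1 : E ≤ 0.4364)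
    (hL : L = 3 * E / 4) (ha' : a = C - s * E) (hb' : b = C + s * E / 2) (ha0 : 0 ≤ a)
    (hs_le : s ≤ 2) (hs_ge : 2 - 2 * E ^ 2 / 3 ≤ s)
    (hC_le : C ≤ 1 - E ^ 2 + E ^ 4 / 6) (hC_ge : 1 - E ^ 2 ≤ C) :
    ∃ m η : ℝ, 0 < s ∧ m ≤ 1 ∧ 0 ≤ η ∧ η ≤ 3 / 2 ∧ 1 ≤ b ∧
      m - s * L = a ∧ m + s * L = b ∧ η * (2 - L ^ 2) = m + s ∧
      0 ≤ s * (1 - L ^ 2 / 2) - b - (m + η * L ^ 2) * (1 - L) - η * L ^ 3 / 3 := by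
  -- The midpoint `(a + b) / 2`; since `s * L = (b - a) / 2`, the line `m + s * u` runs from `a` at
  -- `-L` to `b` at `L`.
  set m := C - s * E / 4 with hm
  have hL0 : 0 < L := by rw [hL]; positivity
  have hL1 : L ≤ 0.3273 := by rw [hL]; linarith
  have hE2 : E ^ 2 ≤ 0.1905 := (pow_le_pow_left₀ hE0.le hE1 2).trans (by norm_num)
  set η := (m + s) / (2 - L ^ 2) with hη
  have hden : 0 < 2 - L ^ 2 := by nlinarith
  have hηeq : η * (2 - L ^ 2) = m + s := div_mul_cancel₀ _ hden.ne'
  have hm0 : 0 ≤ m := by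
    have : m = (a + b) / 2 := by rw [ha', hb']; ring
    have : 0 ≤ b := by rw [hb']; nlinarith
    linarith
  have hs0 : 0 < s := by nlinarith
  have hη0 : 0 ≤ η := by positivity
  have hm_le : m ≤ 1 - E ^ 2 + E ^ 4 / 6 - (2 - 2 * E ^ 2 / 3) * E / 4 := by
    rw [hm]
    nlinarith
  have hη1 : η ≤ 3 / 2 := by
    rw [hη, div_le_iff₀ hden, hL]
    have h1 : E * E ^ 2 ≤ E * 0.1905 := by gcongr
    have h2 : E ^ 2 * E ^ 2 ≤ E ^ 2 * 0.1905 := by gcongr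
    nlinarith
  have hη2 : η * (L ^ 2 - 2 * L ^ 3 / 3) ≤ 3 / 2 * (L ^ 2 - 2 * L ^ 3 / 3) :=
    mul_le_mul_of_nonneg_right hη1 (by nlinarith [mul_pos hL0 hL0])
  have hs2 : (2 - 2 * E ^ 2 / 3) * (1 - E / 4 - 15 * E ^ 2 / 32)
      ≤ s * (1 - E / 4 - 15 * E ^ 2 / 32) :=
    mul_le_mul_of_nonneg_right hs_ge (by linarith)
  have hC2 : C * (2 - 3 * E / 4) ≤ (1 - E ^ 2 + E ^ 4 / 6) * (2 - 3 * E / 4) :=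
    mul_le_mul_of_nonneg_right hC_le (by linarith)
  refine ⟨m, η, hs0, by nlinarith, hη0, hη1, by rw [hb']; nlinarith,
    by rw [ha', hm, hL]; ring, by rw [hb', hm, hL]; ring, hηeq, ?_⟩
  -- What remains of the last claim, up to the term `E ^ 5 / 8`, after inserting the bounds for `s`
  -- and `C` together with `η ≤ 3/2`.
  have hpoly : 0 ≤ E * (1 / 4 - 43 / 96 * E - 31 / 192 * E ^ 2 - 1 / 48 * E ^ 3) := by
    refine mul_nonneg hE0.le ?_
    have h1 : E ^ 2 * E ≤ 0.1905 * 0.4364 := by gcongr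
    nlinarith
  have hE5 : 0 ≤ E ^ 5 / 8 := by positivity
  have hexp : s * (1 - L ^ 2 / 2) - b - (m + η * L ^ 2) * (1 - L) - η * L ^ 3 / 3
      = s * (1 - E / 4 - 15 * E ^ 2 / 32) - C * (2 - 3 * E / 4) - η * (L ^ 2 - 2 * L ^ 3 / 3) := by
    rw [hb', hm, hL]
    ring
  rw [hexp]
  rw [hL] at hη2 ⊢
  linarith

/-- Polynomial comparison functions on the outer pieces. -/
theorem exists_polynomial_pieces {a b L m s η : ℝ} (hL0 : 0 < L) (hL1 : L ≤ 0.3273)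
    (hs0 : 0 < s) (hm1 : m ≤ 1) (hη0 : 0 ≤ η) (hη1 : η ≤ 3 / 2) (hb1 : 1 ≤ b)
    (ha0 : 0 ≤ a) (ha : m - s * L = a) (hb : m + s * L = b) (hηeq : η * (2 - L ^ 2) = m + s)
    (hconst : 0 ≤ s * (1 - L ^ 2 / 2) - b - (m + η * L ^ 2) * (1 - L) - η * L ^ 3 / 3) :
    ∃ p P q Q : ℝ → ℝ, (∀ u, HasDerivAt P (p u) u) ∧ (∀ u, HasDerivAt Q (q u) u) ∧
      Continuous p ∧ Continuous q ∧ p L = b ∧ (∀ u, q u = b - P u + P (-L)) ∧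
      (∀ u ∈ Set.Ioc (-L) L, 0 < p u) ∧ (∀ u ∈ Set.Icc (-L) L, 0 < q u) ∧
      ∀ u ∈ Set.Icc (-L) L, a + P L - P (-u) + Q u - Q (-L) ≤ p u := by
  have hsq : ∀ u ∈ Set.Icc (-L) L, 0 ≤ L ^ 2 - u ^ 2 := fun u hu => by
    rw [sq_sub_sq]
    exact mul_nonneg (by linarith [hu.1]) (by linarith [hu.2])
  -- A quadratic with end values `a` and `b`; `η` is the remaining freedom. The function `q` makes
  -- the supersolution inequality on the fourth piece equivalent to the one for `p` at `u = L`.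
  set p : ℝ → ℝ := fun u => m + s * u + η * (L ^ 2 - u ^ 2) with hp
  set P : ℝ → ℝ := fun u => m * u + s * u ^ 2 / 2 + η * (L ^ 2 * u - u ^ 3 / 3) with hP
  set q : ℝ → ℝ := fun u => b - P u + P (-L) with hq
  set Q : ℝ → ℝ := fun u => (b + P (-L)) * u - (m * u ^ 2 / 2 + s * u ^ 3 / 6 +
    η * (L ^ 2 * u ^ 2 / 2 - u ^ 4 / 12)) with hQ
  have hdP : ∀ u, HasDerivAt P (p u) u := fun u => by
    refine ((((hasDerivAt_id u).const_mul m).add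
      (((hasDerivAt_pow 2 u).const_mul s).div_const 2)).add
      ((((hasDerivAt_id u).const_mul (L ^ 2)).sub
        ((hasDerivAt_pow 3 u).div_const 3)).const_mul η)).congr_deriv ?_
    simp [hp]
    ring
  have hdQ : ∀ u, HasDerivAt Q (q u) u := fun u => by
    refine (((hasDerivAt_id u).const_mul (b + P (-L))).sub
      (((((hasDerivAt_pow 2 u).const_mul m).div_const 2).add
      (((hasDerivAt_pow 3 u).const_mul s).div_const 6)).add
      (((((hasDerivAt_pow 2 u).const_mul (L ^ 2)).div_const 2).sub
        ((hasDerivAt_pow 4 u).div_const 12)).const_mul η))).congr_deriv ?_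
    simp [hq, hP]
    ring
  have hdp : ∀ u, HasDerivAt p (s - 2 * η * u) u := fun u => by
    refine ((((hasDerivAt_id u).const_mul s).const_add m).add
      (((hasDerivAt_pow 2 u).const_sub (L ^ 2)).const_mul η)).congr_deriv ?_
    simp
    ring
  have hpL : p (-L) = a := by
    simp only [hp]
    rw [← ha]
    ring
  refine ⟨p, P, q, Q, hdP, hdQ, by fun_prop, by fun_prop, ?_, fun u => rfl, ?_, ?_, ?_⟩
  · simp only [hp]
    rw [← hb]
    ring
  · intro u hu
    have h2 : s * (-L) < s * u := by
      have := hu.1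
      gcongr
    have h3 : 0 ≤ η * (L ^ 2 - u ^ 2) := mul_nonneg hη0 (hsq u ⟨hu.1.le, hu.2⟩)
    simp only [hp]
    linarith
  · intro u hu
    have h1 : P u - P (-L) = m * (u + L) - s * (L ^ 2 - u ^ 2) / 2 +
        η * (4 * L ^ 3 / 3 - (L - u) ^ 2 * (u + 2 * L) / 3) := by
      simp only [hP]
      ring
    have h2 : 0 ≤ s * (L ^ 2 - u ^ 2) := mul_nonneg hs0.le (hsq u hu)
    have h3 : 0 ≤ (L - u) ^ 2 * (u + 2 * L) :=
      mul_nonneg (sq_nonneg _) (by linarith [hu.1])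
    have h4 : L ^ 3 ≤ 0.3273 ^ 3 := pow_le_pow_left₀ hL0.le hL1 3
    have h5 : η * (4 * L ^ 3 / 3 - (L - u) ^ 2 * (u + 2 * L) / 3) ≤ 3 / 2 * (4 * L ^ 3 / 3) :=
      (mul_le_mul_of_nonneg_left (by linarith) hη0).trans
        (mul_le_mul_of_nonneg_right hη1 (by positivity))
    have h6 : m * (u + L) ≤ 1 * (2 * L) := by
      exact mul_le_mul hm1 (by linarith [hu.2]) (by linarith [hu.1]) zero_le_one
    norm_num at h4
    have h8 : q u = b - (P u - P (-L)) := by simp only [hq]; ring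
    rw [h8, h1]
    linarith
  · intro u hu
    -- The inequality is an equality at `u = -L`, so it suffices that the defect has nonnegative
    -- derivative.
    have hmono := le_of_hasDerivAt_nonneg hu.1
      (f := fun u => p u - (a + P L - P (-u) + Q u - Q (-L)))
      (f' := fun u => s - 2 * η * u - (p (-u) + q u)) (fun u => by
        have h1 : HasDerivAt (fun u => P (-u)) (-p (-u)) u := by
          simpa [Function.comp_def] using (hdP (-u)).comp u (hasDerivAt_neg u)
        refine ((hdp u).sub ((((h1.const_sub (a + P L))).add (hdQ u)).sub_const
          (Q (-L)))).congr_deriv ?_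
        ring) (fun v hv => ?_)
    · simp only [neg_neg, hpL] at hmono
      linarith
    · have hvL : v ≤ L := hv.2.trans hu.2
      -- The relation `η * (2 - L ^ 2) = m + s` removes the term linear in `v`, the only low-order
      -- term of variable sign; the constant term is `hconst`.
      have h1 : s - 2 * η * v - (p (-v) + q v) =
          (s * (1 - L ^ 2 / 2) - b - (m + η * L ^ 2) * (1 - L) - η * L ^ 3 / 3) +
          s / 2 * v ^ 2 + η * v ^ 2 * (1 - v / 3) := by
        simp only [hp, hq, hP]
        linear_combination -v * hηeq
      rw [h1]
      have h2 : 0 ≤ η * v ^ 2 * (1 - v / 3) := mul_nonneg (by positivity) (by linarith)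
      have h3 : 0 ≤ s / 2 * v ^ 2 := by positivity
      linarith

/-- The windows split `[0, 1]` at `2t - 1`, `1 - t` and `3t - 1`. Windows from the first piece lie
in the third, which again gives an exact sine-cosine pair. The second and fourth pieces are coupled
to each other and have rescaled half-width `L`, which tends to `0` as `t` tends to `2/3`;
polynomials suffice there. -/
theorem exists_supersolution_of_lt_two_thirds {t : ℝ} (ht : t ∈ Set.Ico (1 / 2 : ℝ) (2 / 3)) :
    ∃ h : ℝ → ℝ, IntervalIntegrable h volume 0 1 ∧ (∀ x ∈ Set.Ioc (0 : ℝ) 1, 0 < h x) ∧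
      ∀ y ∈ Set.Icc (0 : ℝ) 1,
        ∫ x in |y - t|..min 1 (y + t), h x ≤ criticalValue * h y := by
  obtain ⟨ht0, ht1⟩ := ht
  set k := criticalValue with hk
  set w := 3 * criticalAngle with hw
  set r := Real.sqrt 2 with hr
  have hr2 : r ^ 2 = 2 := Real.sq_sqrt (by norm_num)
  have hr0 : 0 < r := by positivity
  have hr1 : r ≤ 1.41422 := Real.sqrt_le_iff.2 ⟨by norm_num, by norm_num⟩
  have hkw : k * w = r := criticalValue_mul
  have hk0 : 0 < k := criticalValue_pos
  have hang0 := criticalAngle_pos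
  have hw0 : 0 < w := mul_pos (by norm_num) hang0
  have hang := criticalAngle_le
  have hpi := Real.pi_gt_three
  set ρ := 1 / Real.sqrt 3 with hρ
  have hρ0 : 0 < ρ := by positivity
  set θ := w * (2 * t - 1) with hθ
  have hθ0 : 0 ≤ θ := mul_nonneg hw0.le (by linarith)
  -- The distance from the critical case `t = 2/3`, normalized so that `L = 3 * E / 4` and the
  -- bounds on `s` and `C` have rational coefficients.
  set E := r / 2 * (criticalAngle - θ) with hE
  have hE0 : 0 < E := mul_pos (by positivity) (by rw [hθ, hw]; nlinarith)
  have hE1 : E ≤ 0.4364 := by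
    have : E ≤ r / 2 * (617 / 1000) := by
      rw [hE]
      gcongr
      linarith
    linarith
  have hrE : r * E = criticalAngle - θ := by
    rw [hE]
    linear_combination (criticalAngle - θ) / 2 * hr2
  set L := (1 - 3 * t / 2) / k with hL
  have hLE : L = 3 * E / 4 := by
    rw [hL, div_eq_iff hk0.ne', hE, hθ, show 3 * (r / 2 * (criticalAngle - w * (2 * t - 1))) / 4 * k
      = 3 / 4 * (2 / 3 - t) * r * (k * w) by rw [hw]; ring, hkw]
    linear_combination -(3 / 4 * (2 / 3 - t)) * hr2
  obtain ⟨s, hsE, hs_le, hs_ge⟩ := sqrt_two_mul_sin_div_bounds hE0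
  obtain ⟨hC_le, hC_ge⟩ := cos_sqrt_two_mul_bounds hE0.le
  rw [← hr, hrE] at hsE hC_le hC_ge
  set C := Real.cos (criticalAngle - θ) with hC
  have hθeq : θ = criticalAngle - (criticalAngle - θ) := by ring
  have ha : Real.sin θ = ρ * (C - s * E) := by
    rw [hθeq, Real.sin_sub, sin_criticalAngle, cos_criticalAngle, hsE, ← hr]
    ring
  have hb : r / 2 * Real.cos θ = ρ * (C + s * E / 2) := by
    rw [hθeq, Real.cos_sub, sin_criticalAngle, cos_criticalAngle, hsE, ← hr, ← hC]
    linear_combination C * ρ / 2 * hr2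
  have ha0 : 0 ≤ C - s * E := by
    have h1 : 0 ≤ Real.sin θ := Real.sin_nonneg_of_nonneg_of_le_pi hθ0 (by
      have : 0 < r * E := by positivity
      linarith)
    rw [ha] at h1
    exact nonneg_of_mul_nonneg_right h1 hρ0
  obtain ⟨m, η, hs0, hm1, hη0, hη1, hb1, hma, hmb, hηeq, hconst⟩ :=
    exists_polynomial_constants hE0 hE1 hLE rfl rfl ha0 hs_le hs_ge hC_le hC_ge
  have hL0 : 0 < L := by rw [hLE]; positivity
  obtain ⟨p, P, q, Q, hdP, hdQ, hpc, hqc, hpL, hq, hp0, hq0, hineq⟩ :=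
    exists_polynomial_pieces hL0 (by rw [hLE]; linarith) hs0 hm1 hη0 hη1 hb1 ha0 hma hmb hηeq hconst
  set a := C - s * E with ha_def
  set b := C + s * E / 2 with hb_def
  -- This endpoint case settles both the third and the fourth piece.
  have hineqL := hineq L ⟨by linarith, le_rfl⟩
  rw [hpL] at hineqL
  set h : ℝ → ℝ := fun x => if x ≤ 2 * t - 1 then Real.sin (w * x) else
    if x < 1 - t then ρ * p ((x - t / 2) / k) else
    if x ≤ 3 * t - 1 then r / 2 * Real.cos (w * (x - t)) else ρ * q ((x - 3 * t / 2) / k) with hh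
  have hval1 : ∀ x ≤ 2 * t - 1, h x = Real.sin (w * x) := fun x hx => if_pos hx
  have hval2 : ∀ x, 2 * t - 1 < x → x < 1 - t → h x = ρ * p ((x - t / 2) / k) := fun x h1 h2 => by
    simp only [hh, if_neg (not_le.2 h1), if_pos h2]
  have hval3 : ∀ x, 1 - t ≤ x → x ≤ 3 * t - 1 → h x = r / 2 * Real.cos (w * (x - t)) :=
    fun x h1 h2 => by
      simp only [hh, if_neg (not_le.2 (show 2 * t - 1 < x by linarith)), if_neg (not_lt.2 h1),
        if_pos h2]
  have hval4 : ∀ x, 3 * t - 1 < x → h x = ρ * q ((x - 3 * t / 2) / k) :=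
    fun x h1 => by
      simp only [hh, if_neg (not_le.2 (show 2 * t - 1 < x by linarith)),
        if_neg (not_lt.2 (show 1 - t ≤ x by linarith)), if_neg (not_le.2 h1)]
  have hI1 : ∀ a b, a ≤ b → b ≤ 2 * t - 1 → IntervalIntegrable h volume a b ∧
      ∫ x in a..b, h x = k * (r / 2) * (Real.cos (w * a) - Real.cos (w * b)) := by
    intro a b hab hb
    obtain ⟨h1, h2⟩ := integral_eq_sub_of_eqOn_Ioo (h := h) hab
      (fun x hx => hval1 x (hx.2.le.trans hb)) (G := fun x => -(k * (r / 2) * Real.cos (w * x)))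
      (fun x => (hasDerivAt_neg_cos_const_mul w (k * (r / 2)) x).congr_deriv
        (by linear_combination Real.sin (w * x) * (r / 2 * hkw + hr2 / 2))) (by fun_prop)
    exact ⟨h1, by rw [h2]; ring⟩
  have hI2 : ∀ a b, 2 * t - 1 ≤ a → a ≤ b → b ≤ 1 - t → IntervalIntegrable h volume a b ∧
      ∫ x in a..b, h x = k * (ρ * P ((b - t / 2) / k)) - k * (ρ * P ((a - t / 2) / k)) := by
    intro a b ha hab hb
    exact integral_eq_sub_of_eqOn_Ioo (h := h) hab
      (fun x hx => hval2 x (ha.trans_lt hx.1) (hx.2.trans_le hb))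
      (fun x => hasDerivAt_comp_sub_div (fun u => (hdP u).const_mul ρ) hk0.ne' (t / 2) x)
      (by fun_prop)
  have hI3 : ∀ a b, 1 - t ≤ a → a ≤ b → b ≤ 3 * t - 1 → IntervalIntegrable h volume a b ∧
      ∫ x in a..b, h x = k / 2 * (Real.sin (w * (b - t)) - Real.sin (w * (a - t))) := by
    intro a b ha hab hb
    obtain ⟨h1, h2⟩ := integral_eq_sub_of_eqOn_Ioo (h := h) hab
      (fun x hx => hval3 x (ha.trans hx.1.le) (hx.2.le.trans hb))
      (G := fun x => k / 2 * Real.sin (w * (x - t)))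
      (fun x => (hasDerivAt_sin_const_mul_sub w (k / 2) t x).congr_deriv
        (by linear_combination Real.cos (w * (x - t)) * (hkw / 2))) (by fun_prop)
    exact ⟨h1, by rw [h2]; ring⟩
  have hI4 : ∀ a b, 3 * t - 1 ≤ a → a ≤ b → IntervalIntegrable h volume a b ∧
      ∫ x in a..b, h x = k * (ρ * Q ((b - 3 * t / 2) / k)) - k * (ρ * Q ((a - 3 * t / 2) / k)) := by
    intro a b ha hab
    exact integral_eq_sub_of_eqOn_Ioo (h := h) hab (fun x hx => hval4 x (ha.trans_lt hx.1))
      (fun x => hasDerivAt_comp_sub_div (fun u => (hdQ u).const_mul ρ) hk0.ne' (3 * t / 2) x)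
      (by fun_prop)
  have hi3 := hI3 (1 - t) (3 * t - 1) le_rfl (by linarith) le_rfl
  have hmid : ∫ x in (1 - t)..(3 * t - 1), h x = k * (ρ * a) := by
    rw [hi3.2, show w * (1 - t - t) = -θ by rw [hθ]; ring, Real.sin_neg,
      show w * (3 * t - 1 - t) = θ by rw [hθ]; ring, ha]
    ring
  have hi4 := hI4 (3 * t - 1) 1 le_rfl (by linarith)
  have hi2 := hI2 (2 * t - 1) (1 - t) le_rfl (by linarith) le_rfl
  have hL1 : (2 * t - 1 - t / 2) / k = -L := by rw [hL]; ring
  have hL2 : (1 - t - t / 2) / k = L := by rw [hL]; ring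
  have hL3 : (3 * t - 1 - 3 * t / 2) / k = -L := by rw [hL]; ring
  have hL4 : (1 - 3 * t / 2) / k = L := rfl
  rw [hL3, hL4] at hi4
  rw [hL1, hL2] at hi2
  have hcos : ∀ x, 1 - t ≤ x → x ≤ 3 * t - 1 → 0 < Real.cos (w * (x - t)) := by
    intro x h1 h2
    refine Real.cos_pos_of_mem_Ioo ⟨?_, ?_⟩
    · have : w * (t - x) ≤ θ := mul_le_mul_of_nonneg_left (by linarith) hw0.le
      linarith [criticalAngle_lt_pi_div_two, mul_pos hr0 hE0]
    · have : w * (x - t) ≤ θ := mul_le_mul_of_nonneg_left (by linarith) hw0.le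
      linarith [criticalAngle_lt_pi_div_two, mul_pos hr0 hE0]
  refine ⟨h, ?_, ?_, ?_⟩
  · exact (((hI1 0 (2 * t - 1) (by linarith) le_rfl).1.trans hi2.1).trans hi3.1).trans hi4.1
  · intro x hx
    rcases le_or_gt x (2 * t - 1) with h1 | h1
    · rw [hval1 x h1]
      refine Real.sin_pos_of_pos_of_lt_pi (mul_pos hw0 hx.1) ?_
      have : w * x ≤ θ := mul_le_mul_of_nonneg_left h1 hw0.le
      linarith [mul_pos hr0 hE0]
    rcases lt_or_ge x (1 - t) with h2 | h2
    · rw [hval2 x h1 h2]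
      refine mul_pos hρ0 (hp0 _ ⟨?_, ?_⟩)
      · rw [← hL1]
        gcongr
      · rw [← hL2]
        gcongr
    rcases le_or_gt x (3 * t - 1) with h3 | h3
    · rw [hval3 x h2 h3]
      exact mul_pos (by positivity) (hcos x h2 h3)
    · rw [hval4 x h3]
      refine mul_pos hρ0 (hq0 _ ⟨?_, ?_⟩)
      · rw [← hL3]
        gcongr
      · rw [← hL4]
        gcongr
        exact hx.2
  · intro y hy
    rcases le_or_gt y (2 * t - 1) with h1 | h1
    · rw [hval1 y h1, min_eq_right (by linarith), abs_of_nonpos (by linarith [hy.1]), neg_sub,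
        (hI3 (t - y) (y + t) (by linarith) (by linarith [hy.1]) (by linarith)).2,
        add_sub_cancel_right, show w * (t - y - t) = -(w * y) by ring, Real.sin_neg]
      exact le_of_eq (by ring)
    rcases lt_or_ge y (1 - t) with h2 | h2
    · rw [min_eq_right (by linarith), abs_of_nonpos (by linarith), neg_sub, hval2 y h1 h2]
      have hj2 := hI2 (t - y) (1 - t) (by linarith) (by linarith) le_rfl
      have hj4 := hI4 (3 * t - 1) (y + t) le_rfl (by linarith)
      rw [← intervalIntegral.integral_add_adjacent_intervals (hj2.1.trans hi3.1) hj4.1,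
        ← intervalIntegral.integral_add_adjacent_intervals hj2.1 hi3.1, hj2.2, hmid, hj4.2, hL2,
        hL3, show (t - y - t / 2) / k = -((y - t / 2) / k) by ring,
        show (y + t - 3 * t / 2) / k = (y - t / 2) / k by ring]
      have h5 := hineq ((y - t / 2) / k) ⟨by rw [← hL1]; gcongr, by rw [← hL2]; gcongr⟩
      have h6 := mul_le_mul_of_nonneg_left h5 (mul_pos hk0 hρ0).le
      linarith
    rw [min_eq_left (by linarith)]
    rcases le_or_gt y (3 * t - 1) with h3 | h3
    · rw [hval3 y h2 h3]
      have habs : |y - t| ≤ 2 * t - 1 := abs_le.2 ⟨by linarith, by linarith⟩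
      have hj1 := hI1 |y - t| (2 * t - 1) habs le_rfl
      rw [← intervalIntegral.integral_add_adjacent_intervals ((hj1.1.trans hi2.1).trans hi3.1)
          hi4.1,
        ← intervalIntegral.integral_add_adjacent_intervals (hj1.1.trans hi2.1) hi3.1,
        ← intervalIntegral.integral_add_adjacent_intervals hj1.1 hi2.1, hj1.2, hi2.2, hmid, hi4.2,
        cos_mul_abs, ← hθ]
      have h6 := mul_le_mul_of_nonneg_left hineqL (mul_pos hk0 hρ0).le
      have h7 : k * (r / 2 * Real.cos θ) = k * (ρ * b) := by rw [hb]
      linarith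
    · rw [hval4 y h3, abs_of_nonneg (by linarith)]
      have hj2 := hI2 (y - t) (1 - t) (by linarith) (by linarith [hy.2]) le_rfl
      rw [← intervalIntegral.integral_add_adjacent_intervals (hj2.1.trans hi3.1) hi4.1,
        ← intervalIntegral.integral_add_adjacent_intervals hj2.1 hi3.1, hj2.2, hmid, hi4.2, hL2,
        show (y - t - t / 2) / k = (y - 3 * t / 2) / k by ring, hq]
      have h6 := mul_le_mul_of_nonneg_left hineqL (mul_pos hk0 hρ0).le
      linarith

/-! ### The uniform upper bound, and its attainment at `t = 2/3`. -/

theorem abs_eigenvalue_opQ_uniformLaw_le {t ν : ℝ} (ht : t ∈ Set.Icc (0 : ℝ) 2)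
    (hν : (opQ uniformLaw t).HasEigenvalue ν) : |ν| ≤ criticalValue := by
  rcases le_or_gt t (1 / 2) with h1 | h1
  · exact abs_eigenvalue_opQ_le_of_le_half ⟨ht.1, h1⟩ hν
  rcases lt_or_ge t (2 / 3) with h2 | h2
  · obtain ⟨h, hi, hpos, hK⟩ := exists_supersolution_of_lt_two_thirds ⟨h1.le, h2⟩
    exact abs_eigenvalue_opQ_le_of_supersolution ⟨ht.1, by linarith⟩ hi hpos hK hν
  rcases le_or_gt t 1 with h3 | h3
  · obtain ⟨h, hi, hpos, hK⟩ := exists_supersolution_of_two_thirds_le ⟨h2, h3⟩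
    exact abs_eigenvalue_opQ_le_of_supersolution ⟨ht.1, h3⟩ hi hpos hK hν
  · obtain ⟨h, hi, hpos, hK⟩ :=
      exists_supersolution_of_two_thirds_le (t := 1) ⟨by norm_num, le_rfl⟩
    exact abs_eigenvalue_opQ_le_of_one_le h3.le hi hpos hK hν

theorem xiKernel_eq_sign_mul (t x y : ℝ) : xiKernel t x y =
    (if 0 ≤ x then 1 else -1) * (if 0 ≤ y then 1 else -1) * xiKernel t |x| |y| := by
  by_cases hx : 0 ≤ x <;> by_cases hy : 0 ≤ y
  · simp [hx, hy, abs_of_nonneg]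
  · simp [hx, hy, abs_of_nonneg hx, abs_of_neg (not_le.1 hy), xiKernel_neg_right]
  · simp [hx, hy, abs_of_nonneg hy, abs_of_neg (not_le.1 hx), xiKernel_neg_left]
  · simp [hx, hy, abs_of_neg (not_le.1 hy), abs_of_neg (not_le.1 hx), xiKernel_neg_left,
      xiKernel_neg_right]

/-- The eigenfunction is the odd extension of `h`: the signs it introduces cancel against those of
the kernel. -/
theorem hasEigenvalue_opQ_of_integral_eq {t k C : ℝ} {h : ℝ → ℝ} (ht : t ∈ Set.Icc (0 : ℝ) 1)
    (hm : Measurable h) (hb : ∀ x, |h x| ≤ C) (hpos : ∀ x ∈ Set.Ioc (0 : ℝ) 1, 0 < h x)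
    (hK : ∀ y ∈ Set.Icc (0 : ℝ) 1, ∫ x in |y - t|..min 1 (y + t), h x = k * h y) :
    (opQ uniformLaw t).HasEigenvalue k := by
  set e : ℝ → ℝ := fun x => if 0 ≤ x then 1 else -1 with he
  have hee : ∀ x, e x * e x = 1 := fun x => by simp only [he]; split_ifs <;> norm_num
  have hem : Measurable e := Measurable.ite measurableSet_Ici measurable_const measurable_const
  refine hasEigenvalue_opQ_of_ae_eq (f := fun x => e x * h |x|) ?_ ?_ ?_
  · refine MemLp.of_bound (hem.mul (hm.comp measurable_norm)).aestronglyMeasurable C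
      (Filter.Eventually.of_forall fun x => ?_)
    have h1 : |e x| = 1 := by simp only [he]; split_ifs <;> simp
    rw [norm_mul, Real.norm_eq_abs, Real.norm_eq_abs, h1, one_mul]
    exact hb _
  · intro h0
    have h1 : ∀ᵐ x ∂uniformLaw, False := by
      have h2 : ∀ᵐ x ∂uniformLaw, 0 < h |x| := by
        refine ae_uniformLaw ?_
        filter_upwards [Measure.ae_ne volume (0 : ℝ)] with x hx0 hx
        exact hpos _ ⟨abs_pos.2 hx0, abs_le.2 hx⟩
      filter_upwards [h0, h2] with x hx hx'
      have h3 := hee x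
      rcases mul_eq_zero.1 hx with h4 | h4
      · rw [h4] at h3
        norm_num at h3
      · exact hx'.ne' h4
    rw [Filter.eventually_false_iff_eq_bot, ae_eq_bot] at h1
    exact IsProbabilityMeasure.ne_zero uniformLaw h1
  · refine ae_uniformLaw (Filter.Eventually.of_forall fun x hx => ?_)
    have h1 : ∀ y, xiKernel t x y * (e y * h |y|) = e x * (xiKernel t |y| |x| * h |y|) := by
      intro y
      rw [xiKernel_eq_sign_mul, xiKernel_comm t |x|]
      linear_combination e x * xiKernel t |y| |x| * h |y| * hee y
    have hx' : |x| ∈ Set.Icc (0 : ℝ) 1 := ⟨abs_nonneg x, abs_le.2 hx⟩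
    simp_rw [h1]
    rw [integral_const_mul, integral_uniformLaw_comp_abs fun y => xiKernel t y |x| * h y,
      setIntegral_xiKernel_eq ht hx', hK _ hx']
    ring

theorem hasEigenvalue_opQ_two_thirds : (opQ uniformLaw (2 / 3)).HasEigenvalue criticalValue := by
  set k := criticalValue with hk
  set w := 3 * criticalAngle with hw
  set r := Real.sqrt 2 with hr
  have hr2 : r ^ 2 = 2 := Real.sq_sqrt (by norm_num)
  have hr0 : 0 < r := by positivity
  have hr1 : r ≤ 1.42 := Real.sqrt_le_iff.2 ⟨by norm_num, by norm_num⟩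
  have hkw : k * w = r := criticalValue_mul
  have hang0 := criticalAngle_pos
  have hang := criticalAngle_le
  have hw0 : 0 < w := mul_pos (by norm_num) hang0
  have hpi := Real.pi_gt_three
  set h : ℝ → ℝ := fun x => if x ≤ 1 / 3 then Real.sin (w * x) else
    r / 2 * Real.cos (w * (x - 2 / 3)) with hh
  have hval1 : ∀ x ≤ 1 / 3, h x = Real.sin (w * x) := fun x hx => if_pos hx
  have hval2 : ∀ x, 1 / 3 < x → h x = r / 2 * Real.cos (w * (x - 2 / 3)) :=
    fun x hx => if_neg (not_le.2 hx)
  have hI1 : ∀ a b, a ≤ b → b ≤ 1 / 3 → IntervalIntegrable h volume a b ∧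
      ∫ x in a..b, h x = k * (r / 2) * (Real.cos (w * a) - Real.cos (w * b)) := by
    intro a b hab hb
    obtain ⟨h1, h2⟩ := integral_eq_sub_of_eqOn_Ioo (h := h) hab
      (fun x hx => hval1 x (hx.2.le.trans hb)) (G := fun x => -(k * (r / 2) * Real.cos (w * x)))
      (fun x => (hasDerivAt_neg_cos_const_mul w (k * (r / 2)) x).congr_deriv
        (by linear_combination Real.sin (w * x) * (r / 2 * hkw + hr2 / 2))) (by fun_prop)
    exact ⟨h1, by rw [h2]; ring⟩
  have hI2 : ∀ a b, 1 / 3 ≤ a → a ≤ b → IntervalIntegrable h volume a b ∧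
      ∫ x in a..b, h x = k / 2 * (Real.sin (w * (b - 2 / 3)) - Real.sin (w * (a - 2 / 3))) := by
    intro a b ha hab
    obtain ⟨h1, h2⟩ := integral_eq_sub_of_eqOn_Ioo (h := h) hab
      (fun x hx => hval2 x (ha.trans_lt hx.1))
      (G := fun x => k / 2 * Real.sin (w * (x - 2 / 3)))
      (fun x => (hasDerivAt_sin_const_mul_sub w (k / 2) (2 / 3) x).congr_deriv
        (by linear_combination Real.cos (w * (x - 2 / 3)) * (hkw / 2))) (by fun_prop)
    exact ⟨h1, by rw [h2]; ring⟩
  refine hasEigenvalue_opQ_of_integral_eq (h := h) (C := 1) ⟨by norm_num, by norm_num⟩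
    (Measurable.ite measurableSet_Iic (by fun_prop) (by fun_prop)) (fun x => ?_)
    (fun x hx => ?_) (fun y hy => ?_)
  · rcases le_or_gt x (1 / 3) with h1 | h1
    · rw [hval1 x h1]
      exact Real.abs_sin_le_one _
    · rw [hval2 x h1, abs_mul, abs_of_pos (by positivity)]
      have := Real.abs_cos_le_one (w * (x - 2 / 3))
      nlinarith
  · rcases le_or_gt x (1 / 3) with h1 | h1
    · rw [hval1 x h1]
      exact Real.sin_pos_of_pos_of_lt_pi (mul_pos hw0 hx.1) (by nlinarith)
    · rw [hval2 x h1]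
      exact mul_pos (by positivity)
        (Real.cos_pos_of_mem_Ioo ⟨by nlinarith, by nlinarith [hx.2]⟩)
  · rcases le_or_gt y (1 / 3) with h1 | h1
    · rw [hval1 y h1, min_eq_right (by linarith), abs_of_nonpos (by linarith), neg_sub,
        (hI2 (2 / 3 - y) (y + 2 / 3) (by linarith) (by linarith [hy.1])).2, add_sub_cancel_right,
        show w * (2 / 3 - y - 2 / 3) = -(w * y) by ring, Real.sin_neg]
      ring
    · have habs : |y - 2 / 3| ≤ 1 / 3 := abs_le.2 ⟨by linarith, by linarith [hy.2]⟩
      have hi1 := hI1 |y - 2 / 3| (1 / 3) habs le_rfl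
      have hi2 := hI2 (1 / 3) 1 le_rfl (by norm_num)
      -- The constants left by the two integrals cancel because `√2 / 2 * cos criticalAngle = sin
      -- criticalAngle`, which is what determines the angle.
      rw [min_eq_left (by linarith), hval2 y h1,
        ← intervalIntegral.integral_add_adjacent_intervals hi1.1 hi2.1, hi1.2, hi2.2, cos_mul_abs,
        show w * (1 / 3) = criticalAngle by rw [hw]; ring,
        show w * (1 - 2 / 3) = criticalAngle by rw [hw]; ring,
        show w * (1 / 3 - 2 / 3) = -criticalAngle by rw [hw]; ring, Real.sin_neg,
        cos_criticalAngle, sin_criticalAngle, ← hr]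
      linear_combination -(k / (2 * Real.sqrt 3)) * hr2

/-! ### Excluding a large negative eigenvalue at `t = 2/3`. -/

/-- The sign function cut off to `1 / 3 < |x|`. -/
noncomputable def outerSign (x : ℝ) : ℝ :=
  (if 0 ≤ x then 1 else -1) * (if 1 / 3 < |x| then 1 else 0)

theorem measurable_outerSign : Measurable outerSign :=
  (Measurable.ite measurableSet_Ici measurable_const measurable_const).mul
    (Measurable.ite (measurableSet_lt measurable_const measurable_norm) measurable_const
      measurable_const)

theorem abs_outerSign_le (x : ℝ) : |outerSign x| ≤ 1 := by
  unfold outerSign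
  split_ifs <;> simp

theorem outerSign_of_nonneg {x : ℝ} (hx : 0 ≤ x) :
    outerSign x = if 1 / 3 < x then 1 else 0 := by
  rw [outerSign, if_pos hx, abs_of_nonneg hx, one_mul]

theorem abs_xiKernel_sub_outerSign (t x y : ℝ) :
    |xiKernel t x y - outerSign x * outerSign y| =
      |xiKernel t |x| |y| - outerSign |x| * outerSign (|y|)| := by
  have h : xiKernel t x y - outerSign x * outerSign y =
      (if 0 ≤ x then 1 else -1) * (if 0 ≤ y then 1 else -1) *
        (xiKernel t |x| |y| - outerSign |x| * outerSign |y|) := by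
    rw [xiKernel_eq_sign_mul, outerSign_of_nonneg (abs_nonneg x),
      outerSign_of_nonneg (abs_nonneg y), outerSign, outerSign]
    ring
  rw [h, abs_mul]
  split_ifs <;> simp

theorem measurable_xiKernel_sub_outerSign (t : ℝ) :
    Measurable fun p : ℝ × ℝ => xiKernel t p.1 p.2 - outerSign p.1 * outerSign p.2 :=
  (measurable_xiKernel t).sub ((measurable_outerSign.comp measurable_fst).mul
    (measurable_outerSign.comp measurable_snd))

theorem abs_xiKernel_sub_outerSign_le_two (t x y : ℝ) :
    |xiKernel t x y - outerSign x * outerSign y| ≤ 2 := by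
  have h1 : |outerSign x * outerSign y| ≤ 1 := by
    rw [abs_mul]
    exact mul_le_one₀ (abs_outerSign_le x) (abs_nonneg _) (abs_outerSign_le y)
  have h2 : |xiKernel t x y| ≤ 1 := norm_xiKernel_le t x y
  linarith [abs_sub (xiKernel t x y) (outerSign x * outerSign y)]

/-- On `[0, 1]²` the kernel at `2/3` is `1` on `(1/3, 1]²` and `0` on `[0, 1/3)²`. The rank-one term
cancels the first square, so only the mixed rectangles survive, with rows of length at most `2/3`
for `x < 1/3` and `1/3` for `x > 1/3`. -/
theorem integral_abs_xiKernel_sub_outerSign_le {x : ℝ} (hx : x ∈ Set.Icc (0 : ℝ) 1)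
    (hx3 : x ≠ 1 / 3) :
    ∫ y in (0 : ℝ)..1, |xiKernel (2 / 3) x y - outerSign x * outerSign y| ≤ 2 / 3 := by
  set D : ℝ → ℝ := fun y => |xiKernel (2 / 3) x y - outerSign x * outerSign y| with hD
  have hint : ∀ a b, IntervalIntegrable D volume a b := fun a b => by
    rw [intervalIntegrable_iff]
    refine IntegrableOn.of_bound measure_Ioc_lt_top
      (((measurable_xiKernel_sub_outerSign (2 / 3)).comp
        measurable_prodMk_left).norm.aestronglyMeasurable) 2
      (Filter.Eventually.of_forall fun y => ?_)
    rw [Real.norm_eq_abs, abs_abs]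
    exact abs_xiKernel_sub_outerSign_le_two _ _ _
  rw [← intervalIntegral.integral_add_adjacent_intervals (hint 0 (1 / 3)) (hint (1 / 3) 1)]
  have hone : ∀ y, outerSign x * outerSign y = 0 → D y ≤ 1 := fun y hy => by
    simp only [hD, hy, sub_zero]
    exact norm_xiKernel_le _ _ _
  have hbd : ∀ a b c, a ≤ b → (∀ y ∈ Set.Ioc a b, D y ≤ c) → ∫ y in a..b, D y ≤ c * (b - a) := by
    intro a b c hab hc
    have h1 := intervalIntegral.norm_integral_le_of_norm_le_const (f := D) (a := a) (b := b) (C := c)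
      (fun y hy => by
        rw [Set.uIoc_of_le hab] at hy
        rw [Real.norm_eq_abs, abs_of_nonneg (abs_nonneg _)]
        exact hc y hy)
    rw [abs_of_nonneg (sub_nonneg.2 hab)] at h1
    exact (le_abs_self _).trans h1
  rcases lt_or_gt_of_ne hx3 with h1 | h1
  · have hx0 : outerSign x = 0 := by
      rw [outerSign_of_nonneg hx.1, if_neg (not_lt.2 h1.le)]
    have h2 := hbd 0 (1 / 3) 0 (by norm_num) fun y hy => by
      simp only [hD, hx0, zero_mul, sub_zero]
      rw [xiKernel_of_nonneg hx.1 hy.1.le, if_neg, abs_zero]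
      rintro ⟨-, h⟩
      linarith [hy.2]
    have h3 := hbd (1 / 3) 1 1 (by norm_num) fun y hy => hone y (by rw [hx0, zero_mul])
    linarith
  · have h2 := hbd 0 (1 / 3) 1 (by norm_num) fun y hy => hone y (by
      rw [outerSign_of_nonneg hy.1.le, if_neg (not_lt.2 hy.2), mul_zero])
    have h3 := hbd (1 / 3) 1 0 (by norm_num) fun y hy => by
      have hy0 : 0 ≤ y := by linarith [hy.1]
      simp only [hD]
      rw [outerSign_of_nonneg hx.1, outerSign_of_nonneg hy0, if_pos h1, if_pos hy.1,
        xiKernel_of_nonneg hx.1 hy0, if_pos]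
      · simp
      · exact ⟨abs_lt.2 ⟨by linarith [hy.2], by linarith [hx.2, hy.1]⟩, by linarith [hy.1]⟩
    linarith

/-- The quadratic form of `outerSign ⊗ outerSign` is a square, hence nonnegative, and the form of
the remainder is at least `-2/3 * ‖v‖²` by its row bound. -/
theorem neg_le_eigenvalue_opQ_two_thirds {ν : ℝ}
    (hν : (opQ uniformLaw (2 / 3)).HasEigenvalue ν) : -ν ≤ 2 / 3 := by
  obtain ⟨v, hv, hv0⟩ := hν.exists_hasEigenvector
  have hv1 : Integrable (fun x => v x) uniformLaw := integrable_coeFn_Lp_two v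
  have hv2 : Integrable (fun x => v x ^ 2) uniformLaw := (Lp.memLp v).integrable_sq
  set D : ℝ × ℝ → ℝ := fun p => |xiKernel (2 / 3) p.1 p.2 - outerSign p.1 * outerSign p.2| with hD
  have hDm : Measurable D := (measurable_xiKernel_sub_outerSign (2 / 3)).norm
  have hDb : ∀ p, ‖D p‖ ≤ 2 := fun p => by
    rw [Real.norm_eq_abs, abs_abs]
    exact abs_xiKernel_sub_outerSign_le_two _ _ _
  have hjv : Integrable (fun x => outerSign x * v x) uniformLaw :=
    hv1.bdd_mul (c := 1) measurable_outerSign.aestronglyMeasurable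
      (Filter.Eventually.of_forall abs_outerSign_le)
  have hi1 := integrable_xiKernel_mul_prod (2 / 3) hv1 hv1
  have hi2 := hjv.mul_prod hjv
  have hi3 : Integrable (fun p : ℝ × ℝ => D p * (v p.1 ^ 2)) (uniformLaw.prod uniformLaw) :=
    (hv2.comp_fst uniformLaw).bdd_mul hDm.aestronglyMeasurable (Filter.Eventually.of_forall hDb)
  have hi4 : Integrable (fun p : ℝ × ℝ => D p * (v p.2 ^ 2)) (uniformLaw.prod uniformLaw) :=
    (hv2.comp_snd uniformLaw).bdd_mul hDm.aestronglyMeasurable (Filter.Eventually.of_forall hDb)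
  have hI1 : ∫ p, xiKernel (2 / 3) p.1 p.2 * (v p.1 * v p.2) ∂(uniformLaw.prod uniformLaw)
      = ν * ∫ x, v x ^ 2 ∂uniformLaw := by
    rw [integral_prod _ hi1, ← integral_const_mul]
    refine integral_congr_ae ?_
    filter_upwards [ae_eq_of_mem_eigenspace hv] with x hx
    calc ∫ y, xiKernel (2 / 3) x y * (v x * v y) ∂uniformLaw
        = ∫ y, v x * (xiKernel (2 / 3) x y * v y) ∂uniformLaw :=
          integral_congr_ae (Filter.Eventually.of_forall fun y => by ring)
      _ = ν * v x ^ 2 := by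
          rw [integral_const_mul, hx]
          ring
  have hI2 : 0 ≤ ∫ p : ℝ × ℝ, outerSign p.1 * v p.1 * (outerSign p.2 * v p.2) ∂(uniformLaw.prod uniformLaw) := by
    rw [integral_prod_mul (fun x => outerSign x * v x) (fun x => outerSign x * v x)]
    exact mul_self_nonneg _
  have hI3 : ∫ p, D p * (v p.1 ^ 2) ∂(uniformLaw.prod uniformLaw) ≤ 2 / 3 * ∫ x, v x ^ 2 ∂uniformLaw := by
    rw [integral_prod _ hi3, ← integral_const_mul]
    refine integral_mono_ae hi3.integral_prod_left (hv2.const_mul _) (ae_uniformLaw ?_)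
    filter_upwards [Measure.ae_ne volume (1 / 3 : ℝ), Measure.ae_ne volume (-(1 / 3) : ℝ)]
      with x h1 h2 hx
    have h3 : |x| ≠ 1 / 3 := fun h => by
      rcases abs_eq (by norm_num) |>.1 h with h | h
      · exact h1 h
      · exact h2 h
    rw [integral_mul_const]
    refine mul_le_mul_of_nonneg_right ?_ (sq_nonneg _)
    have h4 : ∀ y, D (x, y) = |xiKernel (2 / 3) |x| |y| - outerSign |x| * outerSign (|y|)| :=
      fun y => abs_xiKernel_sub_outerSign _ _ _
    simp_rw [h4]
    rw [integral_uniformLaw_comp_abs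
      fun y => |xiKernel (2 / 3) |x| y - outerSign |x| * outerSign y|]
    exact integral_abs_xiKernel_sub_outerSign_le ⟨abs_nonneg x, abs_le.2 hx⟩ h3
  have hI4 : ∫ p, D p * (v p.2 ^ 2) ∂(uniformLaw.prod uniformLaw) = ∫ p, D p * (v p.1 ^ 2) ∂(uniformLaw.prod uniformLaw) := by
    rw [← integral_prod_swap]
    refine integral_congr_ae (Filter.Eventually.of_forall fun p => ?_)
    simp only [hD, Prod.fst_swap, Prod.snd_swap, xiKernel_comm (2 / 3) p.2, mul_comm (outerSign p.2)]
  -- The remainder is estimated through `|a * b| ≤ (a ^ 2 + b ^ 2) / 2`, the Schur test with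
  -- constant weight.
  have hpt : ∀ p : ℝ × ℝ, outerSign p.1 * v p.1 * (outerSign p.2 * v p.2) ≤
      xiKernel (2 / 3) p.1 p.2 * (v p.1 * v p.2) +
        (D p * (v p.1 ^ 2) / 2 + D p * (v p.2 ^ 2) / 2) := by
    intro p
    have h1 := neg_abs_le ((xiKernel (2 / 3) p.1 p.2 - outerSign p.1 * outerSign p.2) *
      (v p.1 * v p.2))
    rw [abs_mul] at h1
    have h2 : |v p.1 * v p.2| ≤ (v p.1 ^ 2 + v p.2 ^ 2) / 2 :=
      abs_le.2 ⟨by nlinarith [sq_nonneg (v p.1 + v p.2)], by nlinarith [sq_nonneg (v p.1 - v p.2)]⟩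
    have h3 := mul_le_mul_of_nonneg_left h2 (abs_nonneg
      (xiKernel (2 / 3) p.1 p.2 - outerSign p.1 * outerSign p.2))
    simp only [hD]
    linarith
  have hi5 : Integrable (fun p : ℝ × ℝ => D p * (v p.1 ^ 2) / 2 + D p * (v p.2 ^ 2) / 2)
      (uniformLaw.prod uniformLaw) := (hi3.div_const 2).add (hi4.div_const 2)
  have hle := integral_mono hi2 (hi1.add hi5) hpt
  simp only [Pi.add_apply] at hle
  rw [integral_add hi1 hi5,
    integral_add (hi3.div_const 2) (hi4.div_const 2), integral_div, integral_div, hI1, hI4] at hle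
  have hpos : 0 < ∫ x, v x ^ 2 ∂uniformLaw := by
    refine lt_of_le_of_ne (integral_nonneg fun x => sq_nonneg _) fun h => hv0 ?_
    have h1 := (integral_eq_zero_iff_of_nonneg (fun x => sq_nonneg _) hv2).1 h.symm
    rw [Lp.eq_zero_iff_ae_eq_zero]
    filter_upwards [h1] with x hx
    exact pow_eq_zero_iff two_ne_zero |>.1 hx
  nlinarith

theorem mainTheorem2 :
    (∀ t ∈ Set.Icc (0 : ℝ) 2, ∃ ν : ℝ, IsDominantEigenvalue (opQ uniformLaw t) ν) ∧
    ∀ ν₁ : ℝ → ℝ,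
      (∀ t ∈ Set.Icc (0 : ℝ) 2, IsDominantEigenvalue (opQ uniformLaw t) (ν₁ t)) →
        IsLUB ((fun t => |ν₁ t|) '' Set.Icc (0 : ℝ) 2) (ν₁ (2 / 3)) ∧
        ν₁ (2 / 3) = Real.sqrt 2 / 3 * (Real.arctan (1 / Real.sqrt 2))⁻¹ := by
  refine ⟨fun t _ => exists_isDominantEigenvalue_opQ uniformLaw t
    (hasEigenvalue_opQ_uniformLaw_zero t), fun ν₁ hν₁ => ?_⟩
  have hmem : (2 / 3 : ℝ) ∈ Set.Icc (0 : ℝ) 2 := ⟨by norm_num, by norm_num⟩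
  have hval : ν₁ (2 / 3) = criticalValue := by
    obtain ⟨hev, hmax⟩ := hν₁ _ hmem
    have h1 := abs_eigenvalue_opQ_uniformLaw_le hmem hev
    have h2 := hmax _ hasEigenvalue_opQ_two_thirds
    rw [abs_of_pos criticalValue_pos] at h2
    -- The two bounds fix only the absolute value; a negative sign would give `criticalValue ≤ 2/3`.
    rcases abs_choice (ν₁ (2 / 3)) with h | h
    · linarith
    · have h3 := neg_le_eigenvalue_opQ_two_thirds hev
      linarith [criticalValue_ge]
  refine ⟨IsGreatest.isLUB ⟨⟨2 / 3, hmem, ?_⟩, ?_⟩, hval⟩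
  · simp only [hval, abs_of_pos criticalValue_pos]
  · rintro _ ⟨t, ht, rfl⟩
    rw [hval]
    exact abs_eigenvalue_opQ_uniformLaw_le ht (hν₁ t ht).1
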